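/- Let $(M,[g])$ be a smooth conformal manifold of dimension $n\ge 3$ (pseudo-Riemannian, of signature $(2p'+1,2q'+1)$), with standard tractor bundle $\mathcal T$, tractor metric $h$, distinguished isotropic real line subbundle $\mathcal T^1\subset\mathcal T$ and standard tractor connection $\nabla=\nabla^{\mathcal T}$. Let $\mathbb J$ be a smooth orthogonal complex structure on $\mathcal T$ which is parallel for $\nabla$, and let $\mathbf k$ be the vector field on $M$ underlying $\mathbb J$: for every local section $X$ of $\mathcal T^1$ we have $\nabla_{\mathbf k}X-\mathbb JX\in\mathcal T^1$. Let $\mathcal L=\mathcal T^1\oplus\mathbb J\mathcal T^1$ be the complex line subbundle of $\mathcal T$ generated by $\mathcal T^1$. Let $W\subset M$ be open and let $\psi:W\to N$ be a local leaf space of the foliation spanned by $\mathbf k$, that is, a smooth surjective submersion onto a manifold $N$ with $\ker T_x\psi=\mathbb R\,\mathbf k(x)$ for all $x\in W$. If the fibres of $\psi$ are connected, then $N$ inherits an almost CR structure of hypersurface type, i.e. a smooth subbundle $H\subset TN$ of (real) corank one with a smooth complex structure $J_N$ on $H$, as follows. For every $x\in W$, $$H_{\psi(x)}=T_x\psi\bigl(\mathbf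 k(x)^\perp\bigr),$$ where $\mathbf k^\perp\subset TM$ is the orthocomplement of $\mathbf k$ with respect to $[g]$; and for $\xi,\eta\in\mathbf k(x)^\perp$ and any local non-vanishing section $X$ of $\mathcal T^1$ near $x$, $$J_N(T_x\psi\,\xi)=T_x\psi\,\eta\iff \nabla_\eta X-\mathbb J\nabla_\xi X\in\mathcal L_x .$$ Without the assumption on the fibres the same holds for all sufficiently small local leaf spaces: every $x\in W$ has an open neighbourhood $W_0\subset W$ such that for every open subset $W_1\subset W_0$ the leaf space $\psi|_{W_1}:W_1\to\psi(W_1)$ inherits an almost CR structure of hypersurface type on $\psi(W_1)$, given by the same formulas at the points $x\in W_1$. -/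

import Mathlib

open scoped Manifold ContDiff

noncomputable section

namespace ConformalTractor

variable {n : ℕ} {M : Type*} [TopologicalSpace M] [ChartedSpace (EuclideanSpace ℝ (Fin n)) M]
  [IsManifold (𝓡 n) ∞ M]

/-- The vector field `Y` is smooth at `x`. -/
def SmoothFieldAt (Y : ∀ x : M, TangentSpace (𝓡 n) x) (x : M) : Prop :=
  ContMDiffAt (𝓡 n) (𝓡 n).tangent ∞ (fun y ↦ (⟨y, Y y⟩ : TangentBundle (𝓡 n) M)) x

/-- The vector field `Y` is smooth on the set `U`. -/
def SmoothFieldOn (Y : ∀ x : M, TangentSpace (𝓡 n) x) (U : Set M) : Prop :=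
  ContMDiffOn (𝓡 n) (𝓡 n).tangent ∞ (fun y ↦ (⟨y, Y y⟩ : TangentBundle (𝓡 n) M)) U

/-! ### Pseudo-Riemannian metrics, Levi-Civita connection, Schouten tensor -/

/-- A smooth pseudo-Riemannian metric, of any signature, on the `n`-dimensional manifold `M`. -/
structure PseudoRiemannianMetric (n : ℕ) (M : Type*) [TopologicalSpace M]
    [ChartedSpace (EuclideanSpace ℝ (Fin n)) M] [IsManifold (𝓡 n) ∞ M] where
  /-- The bilinear form on the tangent space at `x`. -/
  val (x : M) : TangentSpace (𝓡 n) x →L[ℝ] TangentSpace (𝓡 n) x →L[ℝ] ℝ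
  symm (x : M) (v w : TangentSpace (𝓡 n) x) : val x v w = val x w v
  nondegenerate (x : M) (v : TangentSpace (𝓡 n) x) (h : ∀ w, val x v w = 0) : v = 0
  contMDiff : ContMDiff (𝓡 n)
    ((𝓡 n).prod 𝓘(ℝ, EuclideanSpace ℝ (Fin n) →L[ℝ] EuclideanSpace ℝ (Fin n) →L[ℝ] ℝ)) ∞
    (fun x ↦ Bundle.TotalSpace.mk'
      (EuclideanSpace ℝ (Fin n) →L[ℝ] EuclideanSpace ℝ (Fin n) →L[ℝ] ℝ) x (val x))

/-- The `i`-th vector of the standard basis of the tangent space at `x`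
(which is the model space `ℝⁿ`). -/
def basisVector (x : M) (i : Fin n) : TangentSpace (𝓡 n) x :=
  (EuclideanSpace.single i (1 : ℝ) : EuclideanSpace ℝ (Fin n))

/-- The `i`-th component of a tangent vector with respect to `basisVector`. -/
def component {x : M} (v : TangentSpace (𝓡 n) x) (i : Fin n) : ℝ :=
  (show EuclideanSpace ℝ (Fin n) from v) i

/-- A smooth vector field near `x` with the value `v` at `x`. -/
def extendVector {x : M} (v : TangentSpace (𝓡 n) x) (y : M) : TangentSpace (𝓡 n) y :=
  FiberBundle.extend (EuclideanSpace ℝ (Fin n)) v y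

namespace PseudoRiemannianMetric

variable (g : PseudoRiemannianMetric n M)

/-- The matrix `g_{ij}` of the metric at `x`. -/
def gram (x : M) : Matrix (Fin n) (Fin n) ℝ :=
  fun i j ↦ g.val x (basisVector x i) (basisVector x j)

/-- Raising an index: the tangent vector `w` with `g(w, z) = α z` for a linear form `α`. -/
def sharp (x : M) (α : TangentSpace (𝓡 n) x → ℝ) : TangentSpace (𝓡 n) x :=
  ∑ i, ∑ j, ((g.gram x)⁻¹ i j * α (basisVector x j)) • basisVector x i

/-- The right-hand side of the Koszul formula for `2 g(∇_X Y, Z)` at `x`. -/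
def koszul (X Y Z : ∀ x : M, TangentSpace (𝓡 n) x) (x : M) : ℝ :=
  mvfderiv (𝓡 n) (fun y ↦ g.val y (Y y) (Z y)) x (X x)
    + mvfderiv (𝓡 n) (fun y ↦ g.val y (X y) (Z y)) x (Y x)
    - mvfderiv (𝓡 n) (fun y ↦ g.val y (X y) (Y y)) x (Z x)
    + g.val x (VectorField.mlieBracket (𝓡 n) X Y x) (Z x)
    - g.val x (VectorField.mlieBracket (𝓡 n) X Z x) (Y x)
    - g.val x (VectorField.mlieBracket (𝓡 n) Y Z x) (X x)

/-- The Levi-Civita connection: `g.leviCivita Y x v` is `∇_v Y`, for a vector field `Y` that is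
differentiable near `x` and a tangent vector `v` at `x`. -/
def leviCivita (Y : ∀ x : M, TangentSpace (𝓡 n) x) (x : M) (v : TangentSpace (𝓡 n) x) :
    TangentSpace (𝓡 n) x :=
  g.sharp x fun z ↦ g.koszul (extendVector v) Y (extendVector z) x / 2

/-- The Riemann curvature
`R(u, v) w = ∇_u ∇_v w - ∇_v ∇_u w - ∇_{[u, v]} w` (for any smooth extensions of `u`, `v`, `w`). -/
def riemann (x : M) (u v w : TangentSpace (𝓡 n) x) : TangentSpace (𝓡 n) x :=
  g.leviCivita (fun y ↦ g.leviCivita (extendVector w) y (extendVector v y)) x u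
    - g.leviCivita (fun y ↦ g.leviCivita (extendVector w) y (extendVector u y)) x v
    - g.leviCivita (extendVector w) x
        (VectorField.mlieBracket (𝓡 n) (extendVector u) (extendVector v) x)

/-- The Ricci curvature `Ric(v, w)`, the trace of `u ↦ R(u, v) w`. -/
def ricci (x : M) (v w : TangentSpace (𝓡 n) x) : ℝ :=
  ∑ i, component (g.riemann x (basisVector x i) v w) i

/-- The scalar curvature. -/
def scalarCurvature (x : M) : ℝ :=
  ∑ i, ∑ j, (g.gram x)⁻¹ i j * g.ricci x (basisVector x i) (basisVector x j)

/-- The Schouten tensor `P = (Ric - Sc / (2 (n - 1)) g) / (n - 2)`, in dimension `n ≥ 3`. -/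
def schouten (x : M) (v w : TangentSpace (𝓡 n) x) : ℝ :=
  (g.ricci x v w - g.scalarCurvature x / (2 * ((n : ℝ) - 1)) * g.val x v w) / ((n : ℝ) - 2)

end PseudoRiemannianMetric

/-! ### Conformal structures -/

/-- The metric `g'` equals `Ω² g`, where `Ω` is a smooth positive function. -/
def IsRescaling (g g' : PseudoRiemannianMetric n M) (Ω : M → ℝ) : Prop :=
  ContMDiff (𝓡 n) 𝓘(ℝ) ∞ Ω ∧ (∀ x, 0 < Ω x) ∧
    ∀ x v w, g'.val x v w = Ω x ^ 2 * g.val x v w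

/-- A conformal structure: an equivalence class of pseudo-Riemannian metrics
modulo multiplication by smooth positive functions. -/
structure ConformalStructure (n : ℕ) (M : Type*) [TopologicalSpace M]
    [ChartedSpace (EuclideanSpace ℝ (Fin n)) M] [IsManifold (𝓡 n) ∞ M] where
  /-- The metrics of the conformal class. -/
  metrics : Set (PseudoRiemannianMetric n M)
  nonempty : metrics.Nonempty
  mem_iff : ∀ g ∈ metrics, ∀ g', g' ∈ metrics ↔ ∃ Ω, IsRescaling g g' Ω

/-- The orthocomplement `v^⊥` of a tangent vector, with respect to a conformal structure. -/
def ConformalStructure.orthogonal (c : ConformalStructure n M) {x : M}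
    (v : TangentSpace (𝓡 n) x) : Submodule ℝ (TangentSpace (𝓡 n) x) where
  carrier := {ξ | ∀ g ∈ c.metrics, g.val x v ξ = 0}
  add_mem' := fun {a b} ha hb g hg ↦ by
    rw [map_add, ha g hg, hb g hg, add_zero]
  zero_mem' := fun g _ ↦ map_zero _
  smul_mem' := fun t a ha g hg ↦ by
    rw [map_smul, ha g hg, smul_zero]

/-! ### The standard tractor bundle

A metric `g` in the conformal class (a scale) identifies the fibre at `x` of the standard tractor
bundle with the set of triples `(σ, μ, ρ)` in `ℝ ⊕ T_xM ⊕ ℝ`; the triples that represent the same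
tractor with respect to `g` and to `Ω² g` are related by `changeScale`.  (The middle slot is
written with an upper index, which is raised by `g`.) -/

/-- The triples `(σ, μ, ρ)` that represent the elements of the tractor fibre at `x` in a scale. -/
abbrev TractorSlots (n : ℕ) {M : Type*} [TopologicalSpace M]
    [ChartedSpace (EuclideanSpace ℝ (Fin n)) M] (x : M) : Type :=
  ℝ × TangentSpace (𝓡 n) x × ℝ

/-- The triple that represents in the scale `Ω² g` the tractor which is represented by `t` in the
scale `g`: with `Υ = d log Ω`, the triple `(σ, μ, ρ)` becomes
`(Ω σ, Ω⁻¹ (μ + σ Υ^♯), Ω⁻¹ (ρ - Υ(μ) - |Υ|² σ / 2))`. -/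
def changeScale (g : PseudoRiemannianMetric n M) (Ω : M → ℝ) (x : M) (t : TractorSlots n x) :
    TractorSlots n x :=
  let Υ : TangentSpace (𝓡 n) x → ℝ := fun v ↦ mvfderiv (𝓡 n) Ω x v / Ω x
  (Ω x * t.1,
    (Ω x)⁻¹ • (t.2.1 + t.1 • g.sharp x Υ),
    (Ω x)⁻¹ * (t.2.2 - Υ t.2.1 - Υ (g.sharp x Υ) / 2 * t.1))

/-- The tractor metric `h`, in the scale `g`. -/
def tractorMetric (g : PseudoRiemannianMetric n M) (x : M) (s t : TractorSlots n x) : ℝ :=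
  s.1 * t.2.2 + s.2.2 * t.1 + g.val x s.2.1 t.2.1

/-- The section `s` of the tractor bundle, given by its triples in some scale, is smooth at `x`. -/
def SmoothTractorAt (s : ∀ x : M, TractorSlots n x) (x : M) : Prop :=
  ContMDiffAt (𝓡 n) 𝓘(ℝ) ∞ (fun y ↦ (s y).1) x ∧
    SmoothFieldAt (fun y ↦ (s y).2.1) x ∧
    ContMDiffAt (𝓡 n) 𝓘(ℝ) ∞ (fun y ↦ (s y).2.2) x

/-- The standard tractor connection in the scale `g`:
`∇_v (σ, μ, ρ) = (dσ(v) - g(v, μ), ∇_v μ + ρ v + σ P(v)^♯, dρ(v) - P(v, μ))`. -/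
def tractorConnection (g : PseudoRiemannianMetric n M) (s : ∀ x : M, TractorSlots n x) (x : M)
    (v : TangentSpace (𝓡 n) x) : TractorSlots n x :=
  (mvfderiv (𝓡 n) (fun y ↦ (s y).1) x v - g.val x v (s x).2.1,
    g.leviCivita (fun y ↦ (s y).2.1) x v + (s x).2.2 • v + (s x).1 • g.sharp x (g.schouten x v),
    mvfderiv (𝓡 n) (fun y ↦ (s y).2.2) x v - g.schouten x v (s x).2.1)

/-- The section of the distinguished line subbundle `𝓣¹` (the triples `(0, 0, ρ)`) that is
determined by a scale. -/
def canonicalTractor (x : M) : TractorSlots n x := (0, 0, 1)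

/-- A field of endomorphisms of the standard tractor bundle of a conformal structure, given by its
representatives in all scales. -/
structure TractorEndomorphismField (c : ConformalStructure n M) where
  /-- The representative in the scale `g`. -/
  inScale (g : PseudoRiemannianMetric n M) (hg : g ∈ c.metrics) (x : M) :
    TractorSlots n x →ₗ[ℝ] TractorSlots n x
  compatible (g g' : PseudoRiemannianMetric n M) (hg : g ∈ c.metrics) (hg' : g' ∈ c.metrics)
    (Ω : M → ℝ) (hΩ : IsRescaling g g' Ω) (x : M) (t : TractorSlots n x) :
    inScale g' hg' x (changeScale g Ω x t) = changeScale g Ω x (inScale g hg x t)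

namespace TractorEndomorphismField

variable {c : ConformalStructure n M}

/-- The field `A` is smooth: it maps smooth (local) sections to smooth sections. -/
def IsSmooth (A : TractorEndomorphismField c) : Prop :=
  ∀ g hg x, ∀ s : ∀ x : M, TractorSlots n x, SmoothTractorAt s x →
    SmoothTractorAt (fun y ↦ A.inScale g hg y (s y)) x

/-- The field `A` is orthogonal for the tractor metric. -/
def IsOrthogonal (A : TractorEndomorphismField c) : Prop :=
  ∀ g hg x s t, tractorMetric g x (A.inScale g hg x s) (A.inScale g hg x t) = tractorMetric g x s t

/-- `A ∘ A = - id`. -/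
def IsComplexStructure (A : TractorEndomorphismField c) : Prop :=
  ∀ g hg x t, A.inScale g hg x (A.inScale g hg x t) = -t

/-- The field `A` is parallel for the connection induced by the standard tractor connection,
that is, `∇_v (A s) = A (∇_v s)` for all smooth (local) sections `s`. -/
def IsParallel (A : TractorEndomorphismField c) : Prop :=
  ∀ g hg x, ∀ s : ∀ x : M, TractorSlots n x, SmoothTractorAt s x → ∀ v,
    tractorConnection g (fun y ↦ A.inScale g hg y (s y)) x v =
      A.inScale g hg x (tractorConnection g s x v)

/-- `k` is the vector field underlying the (skew symmetric) field `A`, that is, its image under the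
projection `Π` from adjoint tractors to tangent vectors.  If `X` is the section `(0, 0, 1)` of
`𝓣¹`, then `∇_ξ X = (0, ξ, 0)`, and `Π(A)` is the vector `ξ` for which
`A X` and `∇_ξ X` agree modulo `𝓣¹`. -/
def HasUnderlyingField (A : TractorEndomorphismField c) (k : ∀ x : M, TangentSpace (𝓡 n) x) :
    Prop :=
  ∀ g hg x, k x = (A.inScale g hg x (canonicalTractor x)).2.1

/-- The fibre at `x` (in the scale `g`) of the complex line subbundle of the tractor bundle
that is generated by the real line subbundle `𝓣¹`, for a complex structure `A`. -/
def complexLine (A : TractorEndomorphismField c) (g : PseudoRiemannianMetric n M)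
    (hg : g ∈ c.metrics) (x : M) : Submodule ℝ (TractorSlots n x) :=
  Submodule.span ℝ {canonicalTractor x, A.inScale g hg x (canonicalTractor x)}

end TractorEndomorphismField

/-! ### Local leaf spaces and almost CR structures -/

/-- `ψ : W → N` is a local leaf space for the foliation spanned by the vector field `k`:
`W` is open, and `ψ` is a smooth submersion of `W` onto `N` such that the kernel of `T_xψ` is
spanned by `k x` for all `x ∈ W`.  (The values of `ψ` outside of `W` play no role.) -/
structure IsLocalLeafSpace (m : ℕ) {N : Type*} [TopologicalSpace N]
    [ChartedSpace (EuclideanSpace ℝ (Fin m)) N]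
    (k : ∀ x : M, TangentSpace (𝓡 n) x) (ψ : M → N) (W : Set M) : Prop where
  isOpen : IsOpen W
  smooth : ContMDiffOn (𝓡 n) (𝓡 m) ∞ ψ W
  surjOn : ψ '' W = Set.univ
  submersion : ∀ x ∈ W, Function.Surjective (mfderiv (𝓡 n) (𝓡 m) ψ x)
  ker_eq : ∀ x ∈ W, ∀ v, mfderiv (𝓡 n) (𝓡 m) ψ x v = 0 ↔ v ∈ Submodule.span ℝ {k x}

/-- An almost CR structure of hypersurface type on the open subset `U` of an `m`-dimensional
manifold `N`: a smooth subbundle `H` of corank one of the tangent bundle, with a smooth complex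
structure `J` on `H`.  (The values outside of `U` play no role.) -/
structure AlmostCRStructureOn (m : ℕ) {N : Type*} [TopologicalSpace N]
    [ChartedSpace (EuclideanSpace ℝ (Fin m)) N] [IsManifold (𝓡 m) ∞ N] (U : Set N) where
  /-- The subbundle. -/
  H (y : N) : Submodule ℝ (TangentSpace (𝓡 m) y)
  /-- The complex structure on the subbundle. -/
  J (y : N) : H y →ₗ[ℝ] H y
  corank_one : ∀ y ∈ U, Module.finrank ℝ (H y) + 1 = m
  J_sq : ∀ y ∈ U, ∀ ξ : H y, J y (J y ξ) = -ξ
  /-- `H` has smooth local frames, and `J` maps them to smooth vector fields. -/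
  smooth : ∀ y₀ ∈ U, ∃ V : Set N, IsOpen V ∧ y₀ ∈ V ∧ V ⊆ U ∧
    ∃ (r : ℕ) (X : Fin r → ∀ y, H y),
      (∀ y ∈ V, LinearIndependent ℝ (fun i ↦ X i y) ∧
        Submodule.span ℝ (Set.range fun i ↦ X i y) = ⊤) ∧
      ∀ i, SmoothFieldOn (fun y ↦ (X i y : TangentSpace (𝓡 m) y)) V ∧
        SmoothFieldOn (fun y ↦ (J y (X i y) : TangentSpace (𝓡 m) y)) V

/-- The almost CR structure `S` on the image of `W` under the leaf space projection `ψ` is the one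
inherited from the complex structure `A` on the tractor bundle with underlying vector field `k`:
for every `x ∈ W`, the fibre of the CR subbundle at `ψ x` is the image under `T_xψ` of the
orthocomplement of `k x`, and for `ξ` and `η` in this orthocomplement, the complex structure maps
`T_xψ ξ` to `T_xψ η` if and only if `∇_η X` and `A (∇_ξ X)` agree modulo the complex line generated
by `X`, where `X` is the section of `𝓣¹` determined by a scale. -/
def IsInherited {c : ConformalStructure n M} (A : TractorEndomorphismField c)
    (k : ∀ x : M, TangentSpace (𝓡 n) x) {m : ℕ} {N : Type*} [TopologicalSpace N]
    [ChartedSpace (EuclideanSpace ℝ (Fin m)) N] [IsManifold (𝓡 m) ∞ N]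
    (ψ : M → N) (W : Set M) {U : Set N} (S : AlmostCRStructureOn m U) : Prop :=
  (∀ x ∈ W, S.H (ψ x) =
    (c.orthogonal (k x)).map (mfderiv (𝓡 n) (𝓡 m) ψ x).toLinearMap) ∧
  ∀ g hg, ∀ x ∈ W, ∀ ξ ∈ c.orthogonal (k x), ∀ η ∈ c.orthogonal (k x),
    ∀ hξ : mfderiv (𝓡 n) (𝓡 m) ψ x ξ ∈ S.H (ψ x),
      (S.J (ψ x) ⟨mfderiv (𝓡 n) (𝓡 m) ψ x ξ, hξ⟩ : TangentSpace (𝓡 m) (ψ x)) =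
          mfderiv (𝓡 n) (𝓡 m) ψ x η ↔
        tractorConnection g canonicalTractor x η
          - A.inScale g hg x (tractorConnection g canonicalTractor x ξ) ∈ A.complexLine g hg x

end ConformalTractor

end

/-!
The argument takes place in one fixed scale `g`.  Write `X = (0, 0, 1)`, so that
`A X = (0, k, a)`, and let `K` be the middle block of `A` (`middle`).  Since `A` is an orthogonal
complex structure, `k` is null and nowhere zero, `K k = -a k`, and `K` preserves `k^⊥` and
satisfies `K² = -1` modulo `k` there; on `k^⊥`, another scale changes `K` only modulo `k`.  As
`∇_ξ X` is `(0, ξ, *)`, the condition `∇_η X - A ∇_ξ X ∈ 𝓛` just says that `η - K ξ` is a multiple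
of `k` (`tractorConnection_sub_mem_complexLine_iff`).  So the pairs `(dψ ξ, dψ (K ξ))` with
`ξ ∈ k^⊥` form the graph `crGraph` of a complex structure on the hyperplane `dψ (k^⊥)` of the
tangent space of the leaf space at `ψ x`, and what has to be shown is that this graph depends
on `ψ x` only, and smoothly.

The invariance under the flow of `k` comes from the equation `∇ A = 0` and from the fact that the
Levi-Civita connection has no torsion.  They show that `k^⊥` is preserved: if `[k, ξ]` is a multiple
of `k`, then `k · g(k, ξ) = -2 a g(k, ξ)` (`mvfderiv_val_underlyingField`); and that `K` is preserved
on `k^⊥` modulo `k`: `[k, K ξ] - K [k, ξ]` is a multiple of `k` if `ξ ⊥ k`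
(`mlieBracket_middle_sub_mem`).

To integrate these equations without flows, `ψ` is straightened to the first component `u` of a
diffeomorphism `Φ` onto an open subset of `ℝᵐ × ℝ`, and a vector `v` is lifted to the vector field
`ξ_v` with `dΦ ξ_v = (v, 0)`.  In a small convex box, the quotients `g(k, ξ_v) / g(k, ξ_{v₀})` have
zero derivative along `k`, hence are constant along the fibres; if `ξ_v ⊥ k` along a fibre, the same
holds for `du (K ξ_v)`.  This proves `exists_crGraph_eq`: near each point, the graph depends on
`ψ x` only.  If the fibres are preconnected, then the locally constant graph is constant on each
of them.  Smooth frames are obtained by pulling back the lifts, corrected by multiples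
of `ξ_{v₀}`, along a local section of `ψ` (`exists_section_frame`).
-/

namespace ConformalTractor

variable {n : ℕ} {M : Type*} [TopologicalSpace M] [ChartedSpace (EuclideanSpace ℝ (Fin n)) M]
  [IsManifold (𝓡 n) ∞ M]

/-! ### Complex structures on the tractor bundle in a scale -/

namespace TractorEndomorphismField

variable {c : ConformalStructure n M} {A : TractorEndomorphismField c}
  {k : ∀ x : M, TangentSpace (𝓡 n) x} {g : PseudoRiemannianMetric n M} {hg : g ∈ c.metrics} {x : M}

/-- The block of a field of tractor endomorphisms that maps the middle slot to the middle slot,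
in the scale `g`. -/
noncomputable def middle (A : TractorEndomorphismField c) (g : PseudoRiemannianMetric n M)
    (hg : g ∈ c.metrics) (x : M) : TangentSpace (𝓡 n) x →ₗ[ℝ] TangentSpace (𝓡 n) x :=
  LinearMap.fst ℝ _ ℝ ∘ₗ LinearMap.snd ℝ ℝ _ ∘ₗ A.inScale g hg x ∘ₗ
    LinearMap.inr ℝ ℝ _ ∘ₗ LinearMap.inl ℝ _ ℝ

lemma middle_apply (v : TangentSpace (𝓡 n) x) :
    A.middle g hg x v = (A.inScale g hg x (0, v, 0)).2.1 := rfl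

lemma inScale_apply (t : TractorSlots n x) :
    A.inScale g hg x t = t.1 • A.inScale g hg x (1, 0, 0) + A.inScale g hg x (0, t.2.1, 0)
      + t.2.2 • A.inScale g hg x (canonicalTractor x) := by
  rw [← map_smul, ← map_smul, ← map_add, ← map_add]
  congr 1
  ext <;> simp [canonicalTractor]

/-- An orthogonal complex structure is skew symmetric. -/
lemma tractorMetric_inScale_left (hO : A.IsOrthogonal) (hJ : A.IsComplexStructure)
    (s t : TractorSlots n x) :
    tractorMetric g x (A.inScale g hg x s) t = - tractorMetric g x s (A.inScale g hg x t) := by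
  rw [← hO g hg x s (A.inScale g hg x t), hJ]
  simp [tractorMetric]; ring

lemma inScale_canonicalTractor_fst (hO : A.IsOrthogonal) (hJ : A.IsComplexStructure) :
    (A.inScale g hg x (canonicalTractor x)).1 = 0 := by
  have h := tractorMetric_inScale_left (hg := hg) hO hJ (canonicalTractor x) (canonicalTractor x)
  simp [tractorMetric, canonicalTractor] at h ⊢
  linarith

lemma inScale_canonicalTractor (hO : A.IsOrthogonal) (hJ : A.IsComplexStructure)
    (hk : A.HasUnderlyingField k) :
    A.inScale g hg x (canonicalTractor x) =
      (0, k x, (A.inScale g hg x (canonicalTractor x)).2.2) := by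
  ext1
  · exact inScale_canonicalTractor_fst hO hJ
  · ext1
    · exact (hk g hg x).symm
    · rfl

lemma underlyingField_ne_zero (hO : A.IsOrthogonal) (hJ : A.IsComplexStructure)
    (hk : A.HasUnderlyingField k) (x : M) : k x ≠ 0 := by
  intro h0
  obtain ⟨g, hg⟩ := c.nonempty
  set a := (A.inScale g hg x (canonicalTractor x)).2.2 with ha
  have h1 : A.inScale g hg x (canonicalTractor x) = a • canonicalTractor x := by
    rw [inScale_canonicalTractor hO hJ hk, h0, ← ha]
    ext <;> simp [canonicalTractor]
  have h2 := hJ g hg x (canonicalTractor x)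
  rw [h1, map_smul, h1, smul_smul] at h2
  have h3 := congrArg (fun t : TractorSlots n x ↦ t.2.2) h2
  simp [canonicalTractor] at h3
  nlinarith [mul_self_nonneg a]

lemma val_underlyingField_self (hO : A.IsOrthogonal) (hJ : A.IsComplexStructure)
    (hk : A.HasUnderlyingField k) (hg : g ∈ c.metrics) : g.val x (k x) (k x) = 0 := by
  have h := hO g hg x (canonicalTractor x) (canonicalTractor x)
  rw [inScale_canonicalTractor hO hJ hk] at h
  simpa [tractorMetric, canonicalTractor] using h

lemma inScale_middle_fst (hO : A.IsOrthogonal) (hJ : A.IsComplexStructure)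
    (hk : A.HasUnderlyingField k) (v : TangentSpace (𝓡 n) x) :
    (A.inScale g hg x (0, v, 0)).1 = - g.val x (k x) v := by
  have h := tractorMetric_inScale_left (hg := hg) hO hJ (0, v, 0) (canonicalTractor x)
  rw [inScale_canonicalTractor hO hJ hk] at h
  simp [tractorMetric, canonicalTractor] at h
  rw [h, g.symm]

lemma inScale_top_fst (hO : A.IsOrthogonal) (hJ : A.IsComplexStructure) :
    (A.inScale g hg x (1, 0, 0)).1 = - (A.inScale g hg x (canonicalTractor x)).2.2 := by
  have h := tractorMetric_inScale_left (hg := hg) hO hJ (1, 0, 0) (canonicalTractor x)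
  simpa [tractorMetric, canonicalTractor] using h

/-- The vector field underlying a complex structure is an eigenvector field of the middle block. -/
lemma middle_underlyingField (hO : A.IsOrthogonal) (hJ : A.IsComplexStructure)
    (hk : A.HasUnderlyingField k) :
    A.middle g hg x (k x) = -(A.inScale g hg x (canonicalTractor x)).2.2 • k x := by
  have h := hJ g hg x (canonicalTractor x)
  rw [inScale_canonicalTractor hO hJ hk, inScale_apply] at h
  have h' := congrArg (fun t : TractorSlots n x ↦ t.2.1) h
  simp only [Prod.snd_add, Prod.fst_add, zero_smul, zero_add, Prod.smul_snd, Prod.smul_fst,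
    ← hk g hg x] at h'
  rw [middle_apply, neg_smul, eq_neg_iff_add_eq_zero, h']
  simp [canonicalTractor]

lemma val_middle (hO : A.IsOrthogonal) (hJ : A.IsComplexStructure)
    (hk : A.HasUnderlyingField k) {v : TangentSpace (𝓡 n) x} (hv : g.val x (k x) v = 0) :
    g.val x (k x) (A.middle g hg x v) = 0 := by
  have h := hO g hg x (0, v, 0) (canonicalTractor x)
  rw [inScale_canonicalTractor hO hJ hk] at h
  simpa [tractorMetric, canonicalTractor, inScale_middle_fst hO hJ hk, hv, g.symm x _ (k x),
    ← middle_apply] using h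

/-- On `k^⊥`, the middle block squares to `-1` modulo `k`. -/
lemma middle_middle (hO : A.IsOrthogonal) (hJ : A.IsComplexStructure)
    (hk : A.HasUnderlyingField k) {v : TangentSpace (𝓡 n) x} (hv : g.val x (k x) v = 0) :
    A.middle g hg x (A.middle g hg x v) = -v - (A.inScale g hg x (0, v, 0)).2.2 • k x := by
  have h := hJ g hg x (0, v, 0)
  rw [inScale_apply, inScale_middle_fst hO hJ hk, hv] at h
  have h' := congrArg (fun t : TractorSlots n x ↦ t.2.1) h
  simp only [Prod.snd_add, Prod.fst_add, zero_smul, zero_add, Prod.smul_snd, Prod.smul_fst,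
    ← hk g hg x, ← middle_apply, neg_zero, Prod.snd_neg, Prod.fst_neg] at h'
  rw [← h', add_sub_cancel_right]

/-- Modulo `k`, the action of the middle block on `k^⊥` does not depend on the scale. -/
lemma middle_sub_middle_mem (hO : A.IsOrthogonal) (hJ : A.IsComplexStructure)
    (hk : A.HasUnderlyingField k) {g' : PseudoRiemannianMetric n M} {hg' : g' ∈ c.metrics}
    {v : TangentSpace (𝓡 n) x} (hv : g.val x (k x) v = 0) :
    A.middle g' hg' x v - A.middle g hg x v ∈ Submodule.span ℝ {k x} := by
  obtain ⟨Ω, hΩ⟩ := (c.mem_iff g hg g').1 hg'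
  have hne : Ω x ≠ 0 := (hΩ.2.1 x).ne'
  have h := A.compatible g g' hg hg' Ω hΩ x (0, Ω x • v, 0)
  rw [inScale_apply (g := g')] at h
  have h' := congrArg (fun t : TractorSlots n x ↦ t.2.1) h
  have h1 : (A.inScale g hg x (0, Ω x • v, 0)).1 = 0 := by
    rw [inScale_middle_fst hO hJ hk, map_smul, hv, smul_zero, neg_zero]
  simp only [changeScale, h1, mul_zero, zero_smul, add_zero, Prod.snd_add, Prod.fst_add, zero_add,
    Prod.smul_snd, Prod.smul_fst, ← hk g' hg' x, ← middle_apply, map_smul, smul_smul,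
    inv_mul_cancel₀ hne, one_smul] at h'
  rw [← h', sub_add_cancel_left, ← neg_smul]
  exact Submodule.smul_mem _ _ (Submodule.mem_span_singleton_self _)

end TractorEndomorphismField

lemma ConformalStructure.mem_orthogonal_iff {c : ConformalStructure n M}
    {g : PseudoRiemannianMetric n M} (hg : g ∈ c.metrics) {x : M} {v w : TangentSpace (𝓡 n) x} :
    w ∈ c.orthogonal v ↔ g.val x v w = 0 := by
  refine ⟨fun h ↦ h g hg, fun h g' hg' ↦ ?_⟩
  obtain ⟨Ω, hΩ⟩ := (c.mem_iff g hg g').1 hg'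
  rw [hΩ.2.2, h, mul_zero]

/-! ### The Levi-Civita connection is torsion free -/

/-- The vector field `Y` is differentiable at `x`. -/
abbrev DifferentiableFieldAt (Y : ∀ x : M, TangentSpace (𝓡 n) x) (x : M) : Prop :=
  MDifferentiableAt (𝓡 n) (𝓡 n).tangent (fun y ↦ (⟨y, Y y⟩ : TangentBundle (𝓡 n) M)) x

lemma SmoothFieldAt.mdifferentiableAt {Y : ∀ x : M, TangentSpace (𝓡 n) x} {x : M}
    (hY : SmoothFieldAt Y x) :
    DifferentiableFieldAt Y x :=
  ContMDiffAt.mdifferentiableAt hY (by simp)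

lemma mdifferentiableAt_extendVector {x : M} (v : TangentSpace (𝓡 n) x) :
    DifferentiableFieldAt (extendVector v) x :=
  FiberBundle.mdifferentiableAt_extend (𝓡 n) (EuclideanSpace ℝ (Fin n)) v

@[simp] lemma extendVector_self {x : M} (v : TangentSpace (𝓡 n) x) : extendVector v x = v :=
  FiberBundle.extend_apply_self _ v

namespace PseudoRiemannianMetric

variable (g : PseudoRiemannianMetric n M)

lemma mdifferentiableAt_val {X Y : ∀ x : M, TangentSpace (𝓡 n) x} {x : M}
    (hX : DifferentiableFieldAt X x) (hY : DifferentiableFieldAt Y x) :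
    MDifferentiableAt (𝓡 n) 𝓘(ℝ) (fun y ↦ g.val y (X y) (Y y)) x := by
  have hg := (g.contMDiff x).mdifferentiableAt (by simp)
  have h : MDifferentiableAt (𝓡 n) ((𝓡 n).prod 𝓘(ℝ))
      (fun y ↦ Bundle.TotalSpace.mk' ℝ (E := Bundle.Trivial M ℝ) y (g.val y (X y) (Y y))) x :=
    MDifferentiableAt.clm_bundle_apply₂ (F₁ := EuclideanSpace ℝ (Fin n))
      (F₂ := EuclideanSpace ℝ (Fin n)) (F₃ := ℝ) hg hX hY
  exact ((mdifferentiableAt_totalSpace _ _).1 h).2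

/-- The Koszul formula is tensorial in its first argument. -/
lemma koszul_tensorial {Y Z : ∀ x : M, TangentSpace (𝓡 n) x} {x : M}
    (hY : DifferentiableFieldAt Y x) (hZ : DifferentiableFieldAt Z x) :
    TensorialAt (𝓡 n) (EuclideanSpace ℝ (Fin n)) (fun X ↦ g.koszul X Y Z x) x := by
  have : IsManifold (𝓡 n) (minSmoothness ℝ 2) M := by
    rw [minSmoothness_of_isRCLikeNormedField]; infer_instance
  constructor
  · intro f X hf hX
    have e1 : (fun y ↦ g.val y ((f • X) y) (Z y)) = f * fun y ↦ g.val y (X y) (Z y) := by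
      ext y; simp
    have e2 : (fun y ↦ g.val y ((f • X) y) (Y y)) = f * fun y ↦ g.val y (X y) (Y y) := by
      ext y; simp
    simp only [koszul]
    rw [e1, e2, mvfderiv_mul hf (g.mdifferentiableAt_val hX hZ),
      mvfderiv_mul hf (g.mdifferentiableAt_val hX hY),
      VectorField.mlieBracket_smul_left hf hX, VectorField.mlieBracket_smul_left hf hX]
    simp
    ring
  · intro X X' hX hX'
    have e1 (Z : ∀ x : M, TangentSpace (𝓡 n) x) : (fun y ↦ g.val y ((X + X') y) (Z y)) =
        (fun y ↦ g.val y (X y) (Z y)) + fun y ↦ g.val y (X' y) (Z y) := by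
      ext y; simp
    simp only [koszul]
    rw [e1, e1, mvfderiv_add (g.mdifferentiableAt_val hX hZ) (g.mdifferentiableAt_val hX' hZ),
      mvfderiv_add (g.mdifferentiableAt_val hX hY) (g.mdifferentiableAt_val hX' hY),
      VectorField.mlieBracket_add_left hX hX', VectorField.mlieBracket_add_left hX hX']
    simp
    ring

lemma koszul_extendVector {X Y Z : ∀ x : M, TangentSpace (𝓡 n) x} {x : M}
    (hX : DifferentiableFieldAt X x) (hY : DifferentiableFieldAt Y x)
    (hZ : DifferentiableFieldAt Z x) :
    g.koszul (extendVector (X x)) Y Z x = g.koszul X Y Z x :=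
  (g.koszul_tensorial hY hZ).pointwise (mdifferentiableAt_extendVector _) hX
    (extendVector_self _)

lemma koszul_sub_koszul (X Y Z : ∀ x : M, TangentSpace (𝓡 n) x) (x : M) :
    g.koszul X Y Z x - g.koszul Y X Z x =
      2 * g.val x (VectorField.mlieBracket (𝓡 n) X Y x) (Z x) := by
  have e : (fun y ↦ g.val y (X y) (Y y)) = fun y ↦ g.val y (Y y) (X y) :=
    funext fun y ↦ g.symm y _ _
  simp only [koszul]
  rw [VectorField.mlieBracket_swap_apply (V := Y) (W := X), e]
  simp
  ring

lemma sum_component_smul_basisVector {x : M} (v : TangentSpace (𝓡 n) x) :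
    ∑ i, component v i • basisVector x i = v := by
  have := (EuclideanSpace.basisFun (Fin n) ℝ).sum_repr (show EuclideanSpace ℝ (Fin n) from v)
  simp only [EuclideanSpace.basisFun_apply] at this
  exact this

lemma isUnit_det_gram (x : M) : IsUnit (g.gram x).det := by
  rw [isUnit_iff_ne_zero]
  intro h
  obtain ⟨v, hv, hv'⟩ := Matrix.exists_vecMul_eq_zero_iff.2 h
  apply hv
  have h0 : ∑ i, v i • basisVector x i = 0 := by
    refine g.nondegenerate x _ fun w ↦ ?_
    rw [← sum_component_smul_basisVector w]
    simp only [map_sum, map_smul, sum_apply, smul_apply]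
    refine Finset.sum_eq_zero fun j _ ↦ ?_
    have := congrFun hv' j
    simp only [Matrix.vecMul, dotProduct, gram, Pi.zero_apply] at this
    simp [smul_eq_mul, this]
  ext i
  have h1 := congrArg (fun w : TangentSpace (𝓡 n) x ↦ component w i) h0
  have h3 : (∑ i, v i • EuclideanSpace.single i (1 : ℝ) : EuclideanSpace ℝ (Fin n)) i = 0 := h1
  simpa [Pi.single_apply] using h3

/-- Raising the index of `g(w, ·)` gives back `w`. -/
lemma sharp_val (x : M) (w : TangentSpace (𝓡 n) x) : g.sharp x (fun z ↦ g.val x w z) = w := by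
  conv_rhs => rw [← sum_component_smul_basisVector w]
  simp only [sharp]
  refine Finset.sum_congr rfl fun i _ ↦ ?_
  rw [← Finset.sum_smul]
  congr 1
  have h1 : ∀ j, g.val x w (basisVector x j) = (g.gram x).mulVec (component w) j := by
    intro j
    conv_lhs => rw [← sum_component_smul_basisVector w]
    simp only [map_sum, map_smul, sum_apply, smul_apply,
      Matrix.mulVec, dotProduct, gram, smul_eq_mul]
    exact Finset.sum_congr rfl fun l _ ↦ by rw [g.symm, mul_comm]
  simp only [h1]
  change ((g.gram x)⁻¹.mulVec ((g.gram x).mulVec (component w))) i = _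
  rw [Matrix.mulVec_mulVec, Matrix.nonsing_inv_mul _ (g.isUnit_det_gram x), Matrix.one_mulVec]

lemma sharp_sub (x : M) (α β : TangentSpace (𝓡 n) x → ℝ) :
    g.sharp x α - g.sharp x β = g.sharp x (fun z ↦ α z - β z) := by
  simp only [sharp, ← Finset.sum_sub_distrib, ← sub_smul, ← mul_sub]

/-- The Levi-Civita connection is torsion free. -/
lemma leviCivita_sub_leviCivita {X Y : ∀ x : M, TangentSpace (𝓡 n) x} {x : M}
    (hX : DifferentiableFieldAt X x) (hY : DifferentiableFieldAt Y x) :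
    g.leviCivita Y x (X x) - g.leviCivita X x (Y x) = VectorField.mlieBracket (𝓡 n) X Y x := by
  rw [leviCivita, leviCivita, sharp_sub, ← g.sharp_val x (VectorField.mlieBracket (𝓡 n) X Y x)]
  congr 1
  ext z
  rw [g.koszul_extendVector hX hY (mdifferentiableAt_extendVector z),
    g.koszul_extendVector hY hX (mdifferentiableAt_extendVector z), ← sub_div,
    koszul_sub_koszul, extendVector_self]
  ring

end PseudoRiemannianMetric

lemma leviCivita_zero (g : PseudoRiemannianMetric n M) (x : M) (v : TangentSpace (𝓡 n) x) :
    g.leviCivita (fun _ ↦ 0) x v = 0 := by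
  have h (X Z : ∀ x : M, TangentSpace (𝓡 n) x) : g.koszul X (fun _ ↦ 0) Z x = 0 := by
    have e : (fun _ ↦ 0 : ∀ x : M, TangentSpace (𝓡 n) x) = 0 := rfl
    simp only [PseudoRiemannianMetric.koszul]
    rw [e, VectorField.mlieBracket_zero_right, VectorField.mlieBracket_zero_left]
    simp [mvfderiv_const]
  simp [PseudoRiemannianMetric.leviCivita, PseudoRiemannianMetric.sharp, h]

/-! ### The Lie bracket as a commutator -/

/-- The Lie bracket of vector fields is the commutator of the corresponding derivations, on
functions with values in a normed space. -/
lemma mvfderiv_mlieBracket {F : Type*} [NormedAddCommGroup F] [NormedSpace ℝ F] {u : M → F}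
    {X Y : ∀ x : M, TangentSpace (𝓡 n) x} {x : M} (hu : ContMDiffAt (𝓡 n) 𝓘(ℝ, F) ∞ u x)
    (hX : DifferentiableFieldAt X x) (hY : DifferentiableFieldAt Y x) :
    mvfderiv (𝓡 n) u x (VectorField.mlieBracket (𝓡 n) X Y x) =
      mvfderiv (𝓡 n) (fun y ↦ mvfderiv (𝓡 n) u y (Y y)) x (X x)
        - mvfderiv (𝓡 n) (fun y ↦ mvfderiv (𝓡 n) u y (X y)) x (Y x) := by
  -- everything is transported to the chart around `x`: `û` and `hat Z` represent `u` and `Z` there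
  set φ := extChartAt (𝓡 n) x with hφ
  let E := EuclideanSpace ℝ (Fin n)
  let û : E → F := u ∘ φ.symm
  let hat (Z : ∀ x : M, TangentSpace (𝓡 n) x) : E → E :=
    VectorField.mpullbackWithin 𝓘(ℝ, E) (𝓡 n) φ.symm Z (Set.range (𝓡 n))
  have hxs : x ∈ φ.source := mem_extChartAt_source x
  have hopen : IsOpen φ.source := isOpen_extChartAt_source x
  have hû : ContDiffAt ℝ ∞ û (φ x) := by
    have h := (contMDiffAt_iff.1 hu).2
    exact h.contDiffAt (by simp)
  have hcomp (G : Type _) [NormedAddCommGroup G] [NormedSpace ℝ G] (f : M → G) (f' : E → G)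
      (y : M) (hy : y ∈ φ.source) (hf : ∀ᶠ z in nhds y, f z = f' (φ z))
      (hf' : DifferentiableAt ℝ f' (φ y)) (v : TangentSpace (𝓡 n) y) :
      mvfderiv (𝓡 n) f y v = fderiv ℝ f' (φ y) (mfderiv (𝓡 n) 𝓘(ℝ, E) φ y v) := by
    have h1 : mfderiv (𝓡 n) 𝓘(ℝ, G) f y = mfderiv (𝓡 n) 𝓘(ℝ, G) (f' ∘ φ) y :=
      Filter.EventuallyEq.mfderiv_eq hf
    have h2 := mfderiv_comp (I := 𝓡 n) (I' := 𝓘(ℝ, E)) (I'' := 𝓘(ℝ, G)) y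
      hf'.mdifferentiableAt (mdifferentiableAt_extChartAt (by simpa [hφ] using hy))
    change mfderiv (𝓡 n) 𝓘(ℝ, G) f y v = _
    rw [h1, h2, mfderiv_eq_fderiv]
    rfl
  have hhat (Z : ∀ x : M, TangentSpace (𝓡 n) x) : ∀ᶠ y in nhds x,
      mfderiv (𝓡 n) 𝓘(ℝ, E) φ y (Z y) = hat Z (φ y) := by
    have h := VectorField.eventuallyEq_mpullback_mpullbackWithin_extChartAt (I := 𝓡 n) (x := x)
      (s := Set.univ) Z
    rw [nhdsWithin_univ] at h
    filter_upwards [h, hopen.mem_nhds hxs] with y hy hys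
    conv_lhs => rw [hy]
    obtain ⟨e, he⟩ := isInvertible_mfderiv_extChartAt (I := 𝓡 n) hys
    rw [VectorField.mpullback_apply, ← he, ContinuousLinearMap.inverse_equiv]
    exact e.apply_symm_apply _
  have hdiff (Z : ∀ x : M, TangentSpace (𝓡 n) x) (hZ : DifferentiableFieldAt Z x) :
      DifferentiableAt ℝ (hat Z) (φ x) := by
    have h := MDifferentiableWithinAt.differentiableWithinAt_mpullbackWithin_vectorField
      (I := 𝓡 n) (s := Set.univ) (V := Z) (x := x) hZ.mdifferentiableWithinAt
    exact h.differentiableAt (by simp)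
  have hûd : ∀ᶠ p in nhds (φ x), DifferentiableAt ℝ û p :=
    (hû.of_le (m := 1) (by simp)).eventually (by simp) |>.mono fun p hp ↦
      hp.differentiableAt (by simp)
  have hcont : ContinuousAt φ x := continuousAt_extChartAt x
  have hev (Z : ∀ x : M, TangentSpace (𝓡 n) x) : ∀ᶠ y in nhds x,
      mvfderiv (𝓡 n) u y (Z y) = fderiv ℝ û (φ y) (hat Z (φ y)) := by
    filter_upwards [hhat Z, hcont.eventually hûd, hopen.mem_nhds hxs] with y h1 h2 h3
    rw [hcomp F u û y h3 _ h2, h1]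
    filter_upwards [hopen.mem_nhds h3] with z hz
    simp [û, φ.left_inv hz]
  have h2 : (1 + 1 : WithTop ℕ∞) ≤ ∞ := by rw [one_add_one_eq_two]; exact ENat.LEInfty.out
  have hD : DifferentiableAt ℝ (fderiv ℝ û) (φ x) :=
    (hû.fderiv_right (m := 1) h2).differentiableAt (by simp)
  -- the second derivatives of `u`, whose difference is the bracket by the symmetry of `D² û`
  have hsecond (Z Z' : ∀ x : M, TangentSpace (𝓡 n) x) (hZ : DifferentiableFieldAt Z x) :
      mvfderiv (𝓡 n) (fun y ↦ mvfderiv (𝓡 n) u y (Z y)) x (Z' x) =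
        fderiv ℝ û (φ x) (fderiv ℝ (hat Z) (φ x) (hat Z' (φ x)))
          + fderiv ℝ (fderiv ℝ û) (φ x) (hat Z' (φ x)) (hat Z (φ x)) := by
    rw [hcomp F _ (fun p ↦ fderiv ℝ û p (hat Z p)) x hxs (hev Z) (hD.clm_apply (hdiff Z hZ)),
      (hhat Z').self_of_nhds, fderiv_clm_apply hD (hdiff Z hZ)]
    simp
  have hsymm := (hû.isSymmSndFDerivAt (by simpa using ENat.LEInfty.out)).eq
    (hat X (φ x)) (hat Y (φ x))
  have hbr : mfderiv (𝓡 n) 𝓘(ℝ, E) φ x (VectorField.mlieBracket (𝓡 n) X Y x) =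
      fderiv ℝ (hat Y) (φ x) (hat X (φ x)) - fderiv ℝ (hat X) (φ x) (hat Y (φ x)) := by
    obtain ⟨e, he⟩ := isInvertible_mfderiv_extChartAt (I := 𝓡 n) hxs
    rw [VectorField.mlieBracket, VectorField.mlieBracketWithin_apply, ← he,
      ContinuousLinearMap.inverse_equiv]
    refine (e.apply_symm_apply _).trans ?_
    have hw (Z : ∀ x : M, TangentSpace (𝓡 n) x) :
        fderivWithin ℝ (hat Z) (φ.symm ⁻¹' Set.univ ∩ Set.range (𝓡 n)) (φ x) =
          fderiv ℝ (hat Z) (φ x) := fderivWithin_of_mem_nhds (by simp)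
    rw [← hw, ← hw]
    rfl
  rw [hsecond Y X hY, hsecond X Y hX,
    hcomp F u û x hxs _ (hû.differentiableAt (by simp)), hbr, map_sub, hsymm]
  · abel
  · filter_upwards [hopen.mem_nhds hxs] with z hz
    simp [û, φ.left_inv hz]

/-! ### Derivatives along the underlying field -/

lemma smoothFieldAt_zero (x : M) : SmoothFieldAt (fun _ ↦ 0 : ∀ x : M, TangentSpace (𝓡 n) x) x :=
  Bundle.contMDiff_zeroSection ℝ (TangentSpace (𝓡 n) : M → Type _) x

lemma smoothTractorAt_canonicalTractor (x : M) :
    SmoothTractorAt (canonicalTractor : ∀ x : M, TractorSlots n x) x :=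
  ⟨contMDiffAt_const, smoothFieldAt_zero x, contMDiffAt_const⟩

lemma SmoothFieldAt.smoothTractorAt {ξ : ∀ x : M, TangentSpace (𝓡 n) x} {x : M}
    (hξ : SmoothFieldAt ξ x) : SmoothTractorAt (fun y ↦ ((0, ξ y, 0) : TractorSlots n y)) x :=
  ⟨contMDiffAt_const, hξ, contMDiffAt_const⟩

lemma tractorConnection_canonicalTractor (g : PseudoRiemannianMetric n M) (x : M)
    (v : TangentSpace (𝓡 n) x) :
    tractorConnection g canonicalTractor x v = (0, v, -g.schouten x v 0) := by
  simp [tractorConnection, canonicalTractor, mvfderiv_const, leviCivita_zero]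

namespace TractorEndomorphismField

variable {c : ConformalStructure n M} {A : TractorEndomorphismField c}
  {k : ∀ x : M, TangentSpace (𝓡 n) x} {g : PseudoRiemannianMetric n M} {hg : g ∈ c.metrics} {x : M}
  {ξ : ∀ x : M, TangentSpace (𝓡 n) x}

lemma smoothFieldAt_underlyingField (hs : A.IsSmooth) (hk : A.HasUnderlyingField k) (x : M) :
    SmoothFieldAt k x := by
  obtain ⟨g, hg⟩ := c.nonempty
  have h := (hs g hg x _ (smoothTractorAt_canonicalTractor x)).2.1
  rwa [← funext (hk g hg)] at h

lemma smoothFieldAt_middle (hs : A.IsSmooth) (hξ : SmoothFieldAt ξ x) :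
    SmoothFieldAt (fun y ↦ A.middle g hg y (ξ y)) x :=
  (hs g hg x _ hξ.smoothTractorAt).2.1

lemma contMDiffAt_val_underlyingField (hs : A.IsSmooth) (hO : A.IsOrthogonal)
    (hJ : A.IsComplexStructure) (hk : A.HasUnderlyingField k) (hg : g ∈ c.metrics)
    (hξ : SmoothFieldAt ξ x) : ContMDiffAt (𝓡 n) 𝓘(ℝ) ∞ (fun y ↦ g.val y (k y) (ξ y)) x := by
  have h := (hs g hg x _ hξ.smoothTractorAt).1.neg
  simpa [inScale_middle_fst hO hJ hk] using h

/-- Parallelism of `A`, applied to the section `(0, 0, 1)`, determines the covariant derivative of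
the underlying field. -/
lemma leviCivita_underlyingField_sub_mem (hO : A.IsOrthogonal) (hJ : A.IsComplexStructure)
    (hP : A.IsParallel) (hk : A.HasUnderlyingField k) (v : TangentSpace (𝓡 n) x) :
    g.leviCivita k x v - (A.middle g hg x v
      - (A.inScale g hg x (canonicalTractor x)).2.2 • v) ∈ Submodule.span ℝ {k x} := by
  have h := hP g hg x _ (smoothTractorAt_canonicalTractor x) v
  rw [tractorConnection_canonicalTractor, inScale_apply] at h
  have h' := congrArg (fun t : TractorSlots n x ↦ t.2.1) h
  simp only [tractorConnection, ← hk g hg, inScale_canonicalTractor_fst hO hJ, zero_smul,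
    add_zero, zero_add, Prod.snd_add, Prod.fst_add, Prod.smul_snd, Prod.smul_fst,
    ← middle_apply] at h'
  rw [← eq_sub_iff_add_eq] at h'
  rw [h', show ∀ a b d : TangentSpace (𝓡 n) x, a + b - d - (a - d) = b from fun a b d ↦ by abel]
  exact Submodule.smul_mem _ _ (Submodule.mem_span_singleton_self _)

/-- The function `g(k, ξ)` obeys a homogeneous linear equation along the integral curves of `k`,
for a vector field `ξ` that is projectable along `k`. -/
lemma mvfderiv_val_underlyingField (hs : A.IsSmooth) (hO : A.IsOrthogonal)
    (hJ : A.IsComplexStructure) (hP : A.IsParallel) (hk : A.HasUnderlyingField k)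
    (hg : g ∈ c.metrics) (hξ : SmoothFieldAt ξ x)
    (hkξ : VectorField.mlieBracket (𝓡 n) k ξ x ∈ Submodule.span ℝ {k x}) :
    mvfderiv (𝓡 n) (fun y ↦ g.val y (k y) (ξ y)) x (k x) =
      -2 * (A.inScale g hg x (canonicalTractor x)).2.2 * g.val x (k x) (ξ x) := by
  have hkk := val_underlyingField_self (x := x) hO hJ hk hg
  -- the top slot of `∇_k (A ξ) = A (∇_k ξ)`
  have h := congrArg Prod.fst (hP g hg x _ hξ.smoothTractorAt (k x))
  rw [inScale_apply] at h
  simp only [tractorConnection, Prod.fst_add, Prod.smul_fst, inScale_middle_fst hO hJ hk,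
    inScale_top_fst hO hJ, inScale_canonicalTractor_fst hO hJ, ← middle_apply, zero_smul, add_zero,
    smul_zero, mvfderiv_const] at h
  have hneg : mvfderiv (𝓡 n) (fun y ↦ -g.val y (k y) (ξ y)) x =
      - mvfderiv (𝓡 n) (fun y ↦ g.val y (k y) (ξ y)) x := mvfderiv_fun_neg
  rw [hneg] at h
  have htor := g.leviCivita_sub_leviCivita
    (smoothFieldAt_underlyingField hs hk x).mdifferentiableAt hξ.mdifferentiableAt
  obtain ⟨s, hs'⟩ := Submodule.mem_span_singleton.1 hkξ
  obtain ⟨t, ht⟩ := Submodule.mem_span_singleton.1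
    (leviCivita_underlyingField_sub_mem (g := g) (hg := hg) hO hJ hP hk (ξ x))
  have e1 : g.leviCivita ξ x (k x) = s • k x + (A.middle g hg x (ξ x)
      - (A.inScale g hg x (canonicalTractor x)).2.2 • ξ x + t • k x) := by
    rw [hs', ht, ← htor]; abel
  rw [e1] at h
  simp [hkk] at h
  linarith

/-- The Lie derivative along `k` of the middle block maps `k^⊥` to the line spanned by `k`. -/
lemma mlieBracket_middle_sub_mem (hs : A.IsSmooth) (hO : A.IsOrthogonal)
    (hJ : A.IsComplexStructure) (hP : A.IsParallel) (hk : A.HasUnderlyingField k)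
    (hξ : SmoothFieldAt ξ x) (hkξ : g.val x (k x) (ξ x) = 0) :
    VectorField.mlieBracket (𝓡 n) k (fun y ↦ A.middle g hg y (ξ y)) x
      - A.middle g hg x (VectorField.mlieBracket (𝓡 n) k ξ x) ∈ Submodule.span ℝ {k x} := by
  have hdk := (smoothFieldAt_underlyingField hs hk x).mdifferentiableAt
  rw [← g.leviCivita_sub_leviCivita hdk hξ.mdifferentiableAt, ← g.leviCivita_sub_leviCivita hdk
    (smoothFieldAt_middle (g := g) (hg := hg) hs hξ).mdifferentiableAt]
  obtain ⟨s, hs'⟩ := Submodule.mem_span_singleton.1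
    (leviCivita_underlyingField_sub_mem (g := g) (hg := hg) hO hJ hP hk (ξ x))
  obtain ⟨t, ht⟩ := Submodule.mem_span_singleton.1
    (leviCivita_underlyingField_sub_mem (g := g) (hg := hg) hO hJ hP hk (A.middle g hg x (ξ x)))
  rw [eq_sub_iff_add_eq] at hs' ht
  -- the middle slot of `∇_k (A ξ) = A (∇_k ξ)`
  have h := congrArg (fun t : TractorSlots n x ↦ t.2.1) (hP g hg x _ hξ.smoothTractorAt (k x))
  rw [inScale_apply] at h
  simp only [tractorConnection, Prod.fst_add, Prod.snd_add, Prod.smul_fst, Prod.smul_snd,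
    inScale_middle_fst hO hJ hk, hkξ, ← middle_apply, zero_smul, add_zero, neg_zero,
    mvfderiv_const, ← hk g hg, sub_zero, zero_apply, zero_add] at h
  rw [← eq_sub_iff_add_eq] at h
  rw [h, ← hs', ← ht]
  simp only [map_add, map_sub, map_smul, middle_underlyingField hO hJ hk]
  rw [Submodule.mem_span_singleton]
  refine ⟨-g.schouten x (k x) (ξ x) - (A.inScale g hg x (0, ξ x, 0)).2.2 - t
    - s * (A.inScale g hg x (canonicalTractor x)).2.2, ?_⟩
  simp
  module

end TractorEndomorphismField

/-! ### Straightening a submersion with one-dimensional fibres -/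

/-- The inverse function theorem on a manifold, for functions with values in a normed space. -/
lemma exists_partialDiffeomorph {F : Type*} [NormedAddCommGroup F] [NormedSpace ℝ F]
    {f : M → F} {W : Set M} (hW : IsOpen W) (hf : ContMDiffOn (𝓡 n) 𝓘(ℝ, F) ∞ f W) {x : M}
    (hx : x ∈ W) (hinv : (mvfderiv (𝓡 n) f x).IsInvertible) :
    ∃ Φ : PartialDiffeomorph (𝓡 n) 𝓘(ℝ, F) M F ∞, x ∈ Φ.source ∧ Φ.source ⊆ W ∧
      ∀ y ∈ Φ.source, Φ y = f y := by
  let E := EuclideanSpace ℝ (Fin n)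
  let φ : OpenPartialHomeomorph M E := chartAt E x
  have hxφ : x ∈ φ.source := mem_chart_source E x
  have hφsymm : ContMDiffOn (𝓡 n) (𝓡 n) ∞ φ.symm φ.target := contMDiffOn_chart_symm
  let f' : E → F := f ∘ φ.symm
  have hSo : IsOpen (φ.target ∩ φ.symm ⁻¹' W) := φ.symm.isOpen_inter_preimage hW
  set S := φ.target ∩ φ.symm ⁻¹' W
  have hf' : ContDiffOn ℝ ∞ f' S := by
    rw [← contMDiffOn_iff_contDiffOn]
    exact hf.comp (hφsymm.mono Set.inter_subset_left) fun p hp ↦ hp.2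
  have hxS : φ x ∈ S := ⟨φ.map_source hxφ, by simpa [φ.left_inv hxφ] using hx⟩
  have hd : mvfderiv (𝓡 n) f x = fderiv ℝ f' (φ x) := by
    have h := ((hf.contMDiffAt (hW.mem_nhds hx)).mdifferentiableAt (by simp)).mvfderiv
    rw [fderivWithin_of_mem_nhds (by simp)] at h
    exact h
  rw [hd] at hinv
  obtain ⟨e, he⟩ : ∃ e : E ≃L[ℝ] F, (e : E →L[ℝ] F) = fderiv ℝ f' (φ x) := hinv
  have hfx : ContDiffAt ℝ ∞ f' (φ x) := hf'.contDiffAt (hSo.mem_nhds hxS)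
  have hfe : HasFDerivAt f' (e : E →L[ℝ] F) (φ x) := by
    rw [show (e : E →L[ℝ] F) = fderiv ℝ f' (φ x) from he]
    exact (hfx.differentiableAt (by simp)).hasFDerivAt
  let ψ := hfx.toOpenPartialHomeomorph f' hfe (by simp)
  have hψ (p : E) : ψ p = f' p := rfl
  -- the inverse is smooth where the derivative remains invertible
  let T := S ∩ fderiv ℝ f' ⁻¹' Set.range ((↑) : (E ≃L[ℝ] F) → E →L[ℝ] F)
  have hTo : IsOpen T := (hf'.continuousOn_fderiv_of_isOpen hSo (by simp)).isOpen_inter_preimage hSo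
    ContinuousLinearEquiv.isOpen
  let ψ' := ψ.restrOpen T hTo
  refine ⟨{ toPartialEquiv := (φ.trans ψ').toPartialEquiv
            open_source := (φ.trans ψ').open_source
            open_target := (φ.trans ψ').open_target
            contMDiffOn_toFun := ?_
            contMDiffOn_invFun := ?_ }, ?_, ?_, ?_⟩
  · refine (hf.mono ?_).congr fun y hy ↦ ?_
    · rintro y ⟨hy, -, hy', -⟩
      simpa [φ.left_inv hy] using hy'.2
    · change f (φ.symm (φ y)) = f y
      rw [φ.left_inv hy.1]
  · refine hφsymm.comp (t := φ.target) (g := φ.symm) (f := ψ'.symm) ?_ fun p hp ↦ hp.2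
    rintro p ⟨hp, -⟩
    refine ContMDiffAt.contMDiffWithinAt (ContDiffAt.contMDiffAt ?_)
    have hq := ψ'.map_target hp
    obtain ⟨e', he'⟩ := hq.2.2
    have hfq : ContDiffAt ℝ ∞ f' (ψ'.symm p) := hf'.contDiffAt (hSo.mem_nhds hq.2.1)
    refine ψ'.contDiffAt_symm (f₀' := e') hp ?_ hfq
    rw [he']
    exact (hfq.differentiableAt (by simp)).hasFDerivAt
  · exact ⟨hxφ, hfx.mem_toOpenPartialHomeomorph_source hfe (by simp), hxS, e, he⟩
  · rintro y ⟨hy, -, hy', -⟩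
    simpa [φ.left_inv hy] using hy'.2
  · rintro y ⟨hy, -⟩
    change f (φ.symm (φ y)) = f y
    rw [φ.left_inv hy]

/-- A submersion onto a normed space with one-dimensional kernel is, locally, the first component
of a diffeomorphism. -/
lemma exists_straightening {F : Type*} [NormedAddCommGroup F] [NormedSpace ℝ F]
    [FiniteDimensional ℝ F] {u : M → F} {W : Set M} (hW : IsOpen W)
    (hu : ContMDiffOn (𝓡 n) 𝓘(ℝ, F) ∞ u W) {x : M} (hx : x ∈ W) {k : TangentSpace (𝓡 n) x}
    (hk : k ≠ 0) (hsurj : Function.Surjective (mvfderiv (𝓡 n) u x))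
    (hker : ∀ v, mvfderiv (𝓡 n) u x v = 0 ↔ v ∈ Submodule.span ℝ {k}) :
    ∃ Φ : PartialDiffeomorph (𝓡 n) 𝓘(ℝ, F × ℝ) M (F × ℝ) ∞, x ∈ Φ.source ∧ Φ.source ⊆ W ∧
      ∀ y ∈ Φ.source, (Φ y).1 = u y := by
  let E := EuclideanSpace ℝ (Fin n)
  let φ := chartAt E x
  have hxφ : x ∈ φ.source := mem_chart_source E x
  obtain ⟨D, hD⟩ : ∃ D : E ≃L[ℝ] E,
      (D : E →L[ℝ] E) = mfderiv (𝓡 n) 𝓘(ℝ, E) (extChartAt (𝓡 n) x) x :=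
    isInvertible_mfderiv_extChartAt (mem_extChartAt_source x)
  -- `u` is completed by a coordinate whose derivative does not vanish on `k`
  obtain ⟨l, hl⟩ : ∃ l : E →L[ℝ] ℝ, l (D k) ≠ 0 :=
    SeparatingDual.exists_ne_zero (R := ℝ) (V := E) (x := D k) (D.map_ne_zero_iff.2 hk)
  let t : M → ℝ := fun y ↦ l (extChartAt (𝓡 n) x y)
  have hφ : ContMDiffOn (𝓡 n) 𝓘(ℝ, E) ∞ (extChartAt (𝓡 n) x) φ.source := contMDiffOn_extChartAt
  have ht : ContMDiffOn (𝓡 n) 𝓘(ℝ, ℝ) ∞ t φ.source := l.contMDiff.comp_contMDiffOn hφ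
  have hdt : mfderiv (𝓡 n) 𝓘(ℝ) t x = l ∘L (D : E →L[ℝ] E) := by
    have h := mfderiv_comp (I := 𝓡 n) (I' := 𝓘(ℝ, E)) (I'' := 𝓘(ℝ, ℝ)) x (g := l)
      (f := extChartAt (𝓡 n) x) l.mdifferentiableAt
      (mdifferentiableAt_extChartAt (mem_chart_source _ x))
    rw [← hD, l.mfderiv_eq] at h
    exact h
  have hO : IsOpen (W ∩ φ.source) := hW.inter φ.open_source
  have hf : ContMDiffOn (𝓡 n) 𝓘(ℝ, F × ℝ) ∞ (fun y ↦ (u y, t y)) (W ∩ φ.source) :=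
    (hu.mono Set.inter_subset_left).prodMk_space (ht.mono Set.inter_subset_right)
  have hdu : MDifferentiableAt (𝓡 n) 𝓘(ℝ, F) u x :=
    (hu.contMDiffAt (hW.mem_nhds hx)).mdifferentiableAt (by simp)
  have hdt' : MDifferentiableAt (𝓡 n) 𝓘(ℝ, ℝ) t x :=
    (ht.contMDiffAt (φ.open_source.mem_nhds hxφ)).mdifferentiableAt (by simp)
  have hdf : mvfderiv (𝓡 n) (fun y ↦ (u y, t y)) x =
      (mvfderiv (𝓡 n) u x).prod (mvfderiv (𝓡 n) t x) :=
    HasMFDerivAt.mfderiv ⟨hdu.continuousAt.prodMk hdt'.continuousAt,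
      hdu.hasMFDerivAt.2.prodMk hdt'.hasMFDerivAt.2⟩
  have hdtk (v : TangentSpace (𝓡 n) x) : mvfderiv (𝓡 n) t x v = l (D v) :=
    congrArg (fun L : E →L[ℝ] ℝ ↦ L v) hdt
  have hinj : Function.Injective (mvfderiv (𝓡 n) (fun y ↦ (u y, t y)) x) := by
    rw [hdf, injective_iff_map_eq_zero]
    intro v hv
    rw [ContinuousLinearMap.prod_apply, Prod.mk_eq_zero, hker] at hv
    obtain ⟨s, rfl⟩ := Submodule.mem_span_singleton.1 hv.1
    have h := hv.2
    rw [map_smul, hdtk, smul_eq_mul] at h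
    rw [(mul_eq_zero.1 h).resolve_right hl, zero_smul]
  have hsur : Function.Surjective (mvfderiv (𝓡 n) (fun y ↦ (u y, t y)) x) := by
    rintro ⟨a, b⟩
    obtain ⟨v, hv⟩ := hsurj a
    refine ⟨v + ((b - l (D v)) / l (D k)) • k, ?_⟩
    have hk0 : mvfderiv (𝓡 n) u x k = 0 := (hker k).2 (Submodule.mem_span_singleton_self k)
    rw [hdf, ContinuousLinearMap.prod_apply]
    ext
    · simp [hk0, hv]
    · change mvfderiv (𝓡 n) t x _ = b
      rw [map_add, map_smul, hdtk, hdtk, smul_eq_mul, div_mul_cancel₀ _ hl, add_sub_cancel]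
  let L : E →L[ℝ] F × ℝ := mvfderiv (𝓡 n) (fun y ↦ (u y, t y)) x
  have hinv : (mvfderiv (𝓡 n) (fun y ↦ (u y, t y)) x).IsInvertible :=
    ⟨(LinearEquiv.ofBijective L.toLinearMap ⟨hinj, hsur⟩).toContinuousLinearEquiv, rfl⟩
  obtain ⟨Φ, h1, h2, h3⟩ := exists_partialDiffeomorph hO hf ⟨hx, hxφ⟩ hinv
  exact ⟨Φ, h1, h2.trans Set.inter_subset_left, fun y hy ↦ by rw [h3 y hy]⟩

/-! ### Lifts of constant vector fields -/

section Straightening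

variable {F : Type*} [NormedAddCommGroup F] [NormedSpace ℝ F]
  {Φ : PartialDiffeomorph (𝓡 n) 𝓘(ℝ, F × ℝ) M (F × ℝ) ∞} {u : M → F}
  {k : ∀ x : M, TangentSpace (𝓡 n) x}

lemma mvfderiv_eq_fst (hΦ : ∀ y ∈ Φ.source, (Φ y).1 = u y) {x : M} (hx : x ∈ Φ.source)
    (v : TangentSpace (𝓡 n) x) :
    mvfderiv (𝓡 n) u x v = (mvfderiv (𝓡 n) Φ x v).1 := by
  have h1 : mfderiv (𝓡 n) 𝓘(ℝ, F) u x = mfderiv (𝓡 n) 𝓘(ℝ, F) (Prod.fst ∘ Φ) x :=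
    Filter.EventuallyEq.mfderiv_eq (by
      filter_upwards [Φ.open_source.mem_nhds hx] with y hy using (hΦ y hy).symm)
  have h2 := mfderiv_comp (I := 𝓡 n) (I' := 𝓘(ℝ, F × ℝ)) (I'' := 𝓘(ℝ, F)) x (g := Prod.fst)
    (ContinuousLinearMap.fst ℝ F ℝ).mdifferentiableAt (Φ.mdifferentiableAt (by simp) hx)
  have h3 : mfderiv 𝓘(ℝ, F × ℝ) 𝓘(ℝ, F) (Prod.fst : F × ℝ → F) (Φ x) =
      ContinuousLinearMap.fst ℝ F ℝ := (ContinuousLinearMap.fst ℝ F ℝ).mfderiv_eq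
  rw [h3] at h2
  change mfderiv (𝓡 n) 𝓘(ℝ, F) u x v = _
  rw [h1, h2]
  rfl

lemma mfderiv_isInvertible {x : M} (hx : x ∈ Φ.source) :
    (mfderiv (𝓡 n) 𝓘(ℝ, F × ℝ) Φ x).IsInvertible :=
  ⟨(Φ.isLocalDiffeomorphAt _ _ _ hx).mfderivToContinuousLinearEquiv (by simp), rfl⟩

/-- The value at `x` of the vector field that lifts the constant vector field `v` along the
submersion `u`, where `u` is the first component of the diffeomorphism `Φ`. -/
noncomputable def constantLift (Φ : PartialDiffeomorph (𝓡 n) 𝓘(ℝ, F × ℝ) M (F × ℝ) ∞) (x : M) :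
    F →ₗ[ℝ] TangentSpace (𝓡 n) x :=
  ((mfderiv (𝓡 n) 𝓘(ℝ, F × ℝ) Φ x).inverse : F × ℝ →L[ℝ] TangentSpace (𝓡 n) x).toLinearMap ∘ₗ
    LinearMap.inl ℝ F ℝ

lemma mvfderiv_constantLift (hΦ : ∀ y ∈ Φ.source, (Φ y).1 = u y) {x : M} (hx : x ∈ Φ.source)
    (v : F) : mvfderiv (𝓡 n) u x (constantLift Φ x v) = v := by
  rw [mvfderiv_eq_fst hΦ hx]
  obtain ⟨e, he⟩ := mfderiv_isInvertible hx
  have h : mvfderiv (𝓡 n) Φ x (constantLift Φ x v) = (v, 0) := by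
    change mfderiv (𝓡 n) 𝓘(ℝ, F × ℝ) Φ x (constantLift Φ x v) = _
    simp only [constantLift]
    rw [← he, ContinuousLinearMap.inverse_equiv]
    exact e.apply_symm_apply _
  rw [h]

lemma smoothFieldAt_constantLift [CompleteSpace F] {x : M} (hx : x ∈ Φ.source) (v : F) :
    SmoothFieldAt (fun y ↦ constantLift Φ y v) x := by
  have hc : ContMDiffAt 𝓘(ℝ, F × ℝ) 𝓘(ℝ, F × ℝ).tangent ∞
      (fun y ↦ (⟨y, ((v, 0) : F × ℝ)⟩ : TangentBundle 𝓘(ℝ, F × ℝ) (F × ℝ))) (Φ x) :=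
    contMDiffAt_vectorSpace_iff_contDiffAt.2 contDiffAt_const
  exact ContMDiffAt.mpullback_vectorField_preimage (n := ∞) hc
    (Φ.contMDiffOn.contMDiffAt (Φ.open_source.mem_nhds hx)) (mfderiv_isInvertible hx) (by simp)

/-- A function with vanishing derivative along the fibres of `u` is constant on the part of a fibre
inside a convex box, in straightened coordinates. -/
lemma eq_of_mvfderiv_eq_zero {G : Type*} [NormedAddCommGroup G] [NormedSpace ℝ G]
    (hΦ : ∀ y ∈ Φ.source, (Φ y).1 = u y) {B : Set (F × ℝ)} (hBo : IsOpen B) (hB : Convex ℝ B)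
    (hBΦ : B ⊆ Φ.target) {x₁ x₂ : M} (h₁ : x₁ ∈ Φ.source) (h₁B : Φ x₁ ∈ B) (h₂ : x₂ ∈ Φ.source)
    (h₂B : Φ x₂ ∈ B) (h₁₂ : u x₁ = u x₂)
    (hker : ∀ x ∈ Φ.source, ∀ v, mvfderiv (𝓡 n) u x v = 0 → v ∈ Submodule.span ℝ {k x})
    {f : M → G} (hf : ∀ x ∈ Φ.source, Φ x ∈ B → u x = u x₁ →
      MDifferentiableAt (𝓡 n) 𝓘(ℝ, G) f x ∧ mvfderiv (𝓡 n) f x (k x) = 0) : f x₁ = f x₂ := by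
  -- `γ` is the preimage of the segment from `Φ x₁` to `Φ x₂`, which stays in one fibre of `u`
  let p : ℝ → F × ℝ := AffineMap.lineMap (Φ x₁) (Φ x₂)
  have hp0 : p 0 = Φ x₁ := AffineMap.lineMap_apply_zero _ _
  have hp1 : p 1 = Φ x₂ := AffineMap.lineMap_apply_one _ _
  have hpfst (s : ℝ) : (p s).1 = u x₁ := by
    have : (Φ x₂).1 = (Φ x₁).1 := by rw [hΦ _ h₁, hΦ _ h₂, h₁₂]
    simp [p, AffineMap.lineMap_apply, this, hΦ _ h₁]
  have hpB (s : ℝ) (hs : s ∈ Set.Icc (0 : ℝ) 1) : p s ∈ B := hB.lineMap_mem h₁B h₂B hs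
  have hpd : Differentiable ℝ p := by
    have hp : p = fun s ↦ s • (Φ x₂ - Φ x₁) + Φ x₁ :=
      funext fun s ↦ AffineMap.lineMap_apply_module' _ _ _
    rw [hp]
    fun_prop
  let γ : ℝ → M := fun s ↦ Φ.symm (p s)
  have hΦγ (s : ℝ) (hs : p s ∈ B) : Φ (γ s) = p s := Φ.right_inv (hBΦ hs)
  have hγs (s : ℝ) (hs : p s ∈ B) : γ s ∈ Φ.source := Φ.map_target (hBΦ hs)
  have hγu (s : ℝ) (hs : p s ∈ B) : u (γ s) = u x₁ := by
    rw [← hΦ _ (hγs s hs), hΦγ s hs, hpfst]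
  have hderiv (s : ℝ) (hs : s ∈ Set.Icc (0 : ℝ) 1) : HasDerivAt (fun s ↦ f (γ s)) 0 s := by
    have hsB := hpB s hs
    have hγd : MDifferentiableAt 𝓘(ℝ) (𝓡 n) γ s :=
      (Φ.symm.mdifferentiableAt (by simp) (hBΦ hsB)).comp s (hpd s).mdifferentiableAt
    obtain ⟨hfd, hfk⟩ := hf (γ s) (hγs s hsB) (by rwa [hΦγ s hsB]) (hγu s hsB)
    have hud : MDifferentiableAt (𝓡 n) 𝓘(ℝ, F) u (γ s) := by
      have h := (ContinuousLinearMap.fst ℝ F ℝ).mdifferentiableAt.comp (γ s)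
        (Φ.mdifferentiableAt (by simp) (hγs s hsB))
      refine h.congr_of_eventuallyEq ?_
      filter_upwards [Φ.open_source.mem_nhds (hγs s hsB)] with y hy using (hΦ y hy).symm
    have hu0 : mvfderiv (𝓡 n) u (γ s) (mfderiv 𝓘(ℝ) (𝓡 n) γ s (1 : ℝ)) = 0 := by
      have h := mfderiv_comp_apply s hud hγd (1 : ℝ)
      have h' : mfderiv 𝓘(ℝ) 𝓘(ℝ, F) (u ∘ γ) s = mfderiv 𝓘(ℝ) 𝓘(ℝ, F) (fun _ ↦ u x₁) s := by
        refine Filter.EventuallyEq.mfderiv_eq ?_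
        filter_upwards [hpd.continuous.continuousAt.preimage_mem_nhds (hBo.mem_nhds hsB)]
          with t ht using hγu t ht
      rw [h', mfderiv_const] at h
      exact h.symm
    obtain ⟨r, hr⟩ := Submodule.mem_span_singleton.1 (hker _ (hγs s hsB) _ hu0)
    have hfγ : DifferentiableAt ℝ (f ∘ γ) s := (hfd.comp s hγd).differentiableAt
    have h0 : fderiv ℝ (f ∘ γ) s 1 = 0 := by
      rw [← mfderiv_eq_fderiv]
      refine (mfderiv_comp_apply s hfd hγd (1 : ℝ)).trans ?_
      rw [← hr, map_smul]
      change r • mvfderiv (𝓡 n) f (γ s) (k (γ s)) = 0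
      rw [hfk, smul_zero]
    have := hfγ.hasDerivAt
    rwa [← fderiv_apply_one_eq_deriv, h0] at this
  have h := constant_of_has_deriv_right_zero (f := fun s ↦ f (γ s)) (a := 0) (b := 1)
    (fun s hs ↦ (hderiv s hs).continuousAt.continuousWithinAt)
    (fun s hs ↦ (hderiv s ⟨hs.1, hs.2.le⟩).hasDerivWithinAt) 1 (by simp)
  have e1 : γ 0 = x₁ := by simp only [γ, hp0]; exact Φ.left_inv h₁
  have e2 : γ 1 = x₂ := by simp only [γ, hp1]; exact Φ.left_inv h₂
  simpa [e1, e2] using h.symm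

end Straightening

/-! ### The leaf space in charts -/

section

lemma contMDiffAt_mvfderiv_apply {F : Type*} [NormedAddCommGroup F] [NormedSpace ℝ F] {u : M → F}
    {Y : ∀ x : M, TangentSpace (𝓡 n) x} {x : M} (hu : ContMDiffAt (𝓡 n) 𝓘(ℝ, F) ∞ u x)
    (hY : SmoothFieldAt Y x) :
    ContMDiffAt (𝓡 n) 𝓘(ℝ, F) ∞ (fun y ↦ mvfderiv (𝓡 n) u y (Y y)) x := by
  have h1 := ContMDiffAt.clm_apply_of_inCoordinates (b₁ := id) (b₂ := u)
    (ϕ := fun y ↦ mfderiv (𝓡 n) 𝓘(ℝ, F) u y) (v := Y) (hu.mfderiv_const (m := ∞) (by simp)) hY hu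
  exact (contMDiff_snd_tangentBundle_modelSpace F 𝓘(ℝ, F)).contMDiffAt.comp x h1

variable {m : ℕ} {N : Type*} [TopologicalSpace N] [ChartedSpace (EuclideanSpace ℝ (Fin m)) N]
  [IsManifold (𝓡 m) ∞ N]

namespace IsLocalLeafSpace

variable {k : ∀ x : M, TangentSpace (𝓡 n) x} {ψ : M → N} {W : Set M}

lemma contMDiffOn_chart (hψ : IsLocalLeafSpace m k ψ W) (y₀ : N) :
    ContMDiffOn (𝓡 n) 𝓘(ℝ, EuclideanSpace ℝ (Fin m)) ∞ (fun x ↦ extChartAt (𝓡 m) y₀ (ψ x))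
      (W ∩ ψ ⁻¹' (chartAt (EuclideanSpace ℝ (Fin m)) y₀).source) :=
  contMDiffOn_extChartAt.comp (hψ.smooth.mono Set.inter_subset_left) fun _ hx ↦ hx.2

lemma isOpen_inter_chart (hψ : IsLocalLeafSpace m k ψ W) (y₀ : N) :
    IsOpen (W ∩ ψ ⁻¹' (chartAt (EuclideanSpace ℝ (Fin m)) y₀).source) :=
  hψ.smooth.continuousOn.isOpen_inter_preimage hψ.isOpen (chartAt _ y₀).open_source

lemma mvfderiv_chart (hψ : IsLocalLeafSpace m k ψ W) {y₀ : N} {x : M} (hx : x ∈ W)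
    (hy : ψ x ∈ (chartAt (EuclideanSpace ℝ (Fin m)) y₀).source) (v : TangentSpace (𝓡 n) x) :
    mvfderiv (𝓡 n) (fun x ↦ extChartAt (𝓡 m) y₀ (ψ x)) x v =
      (trivializationAt (EuclideanSpace ℝ (Fin m)) (TangentSpace (𝓡 m)) y₀).continuousLinearMapAt ℝ
        (ψ x) (mfderiv (𝓡 n) (𝓡 m) ψ x v) := by
  rw [TangentBundle.continuousLinearMapAt_trivializationAt hy]
  exact mfderiv_comp_apply x (g := extChartAt (𝓡 m) y₀) (mdifferentiableAt_extChartAt hy)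
    ((hψ.smooth.contMDiffAt (hψ.isOpen.mem_nhds hx)).mdifferentiableAt (by simp)) v

lemma mfderiv_eq_symmL (hψ : IsLocalLeafSpace m k ψ W) {y₀ : N} {x : M} (hx : x ∈ W)
    (hy : ψ x ∈ (chartAt (EuclideanSpace ℝ (Fin m)) y₀).source) (v : TangentSpace (𝓡 n) x) :
    mfderiv (𝓡 n) (𝓡 m) ψ x v =
      (trivializationAt (EuclideanSpace ℝ (Fin m)) (TangentSpace (𝓡 m)) y₀).symmL ℝ
        (ψ x) (mvfderiv (𝓡 n) (fun x ↦ extChartAt (𝓡 m) y₀ (ψ x)) x v) := by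
  rw [hψ.mvfderiv_chart hx hy, Bundle.Trivialization.symmL_continuousLinearMapAt _ hy]

lemma mvfderiv_chart_eq_zero_iff (hψ : IsLocalLeafSpace m k ψ W) {y₀ : N} {x : M} (hx : x ∈ W)
    (hy : ψ x ∈ (chartAt (EuclideanSpace ℝ (Fin m)) y₀).source) (v : TangentSpace (𝓡 n) x) :
    mvfderiv (𝓡 n) (fun x ↦ extChartAt (𝓡 m) y₀ (ψ x)) x v = 0 ↔
      v ∈ Submodule.span ℝ {k x} := by
  rw [← hψ.ker_eq x hx]
  refine ⟨fun h ↦ ?_, fun h ↦ ?_⟩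
  · rw [hψ.mfderiv_eq_symmL hx hy, h, map_zero]
  · rw [hψ.mvfderiv_chart hx hy, h, map_zero]

/-- Near each point, a leaf space projection is in a chart of the leaf space the first component of
a diffeomorphism. -/
lemma exists_straightening (hψ : IsLocalLeafSpace m k ψ W) (y₀ : N) {x : M} (hx : x ∈ W)
    (hy : ψ x ∈ (chartAt (EuclideanSpace ℝ (Fin m)) y₀).source) (hk : k x ≠ 0) :
    ∃ Φ : PartialDiffeomorph (𝓡 n) 𝓘(ℝ, EuclideanSpace ℝ (Fin m) × ℝ) M
        (EuclideanSpace ℝ (Fin m) × ℝ) ∞, x ∈ Φ.source ∧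
      Φ.source ⊆ W ∩ ψ ⁻¹' (chartAt (EuclideanSpace ℝ (Fin m)) y₀).source ∧
      ∀ z ∈ Φ.source, (Φ z).1 = extChartAt (𝓡 m) y₀ (ψ z) := by
  refine ConformalTractor.exists_straightening (hψ.isOpen_inter_chart y₀)
    (hψ.contMDiffOn_chart y₀) ⟨hx, hy⟩ hk (fun w ↦ ?_) (hψ.mvfderiv_chart_eq_zero_iff hx hy)
  obtain ⟨v, hv⟩ := hψ.submersion x hx
    ((trivializationAt (EuclideanSpace ℝ (Fin m)) (TangentSpace (𝓡 m)) y₀).symmL ℝ (ψ x) w)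
  exact ⟨v, by rw [hψ.mvfderiv_chart hx hy, hv,
    Bundle.Trivialization.continuousLinearMapAt_symmL _ hy]⟩

end IsLocalLeafSpace

end

/-! ### The induced structure is constant along the leaves -/

section

variable {m : ℕ} {N : Type*} [TopologicalSpace N]
  [ChartedSpace (EuclideanSpace ℝ (Fin m)) N] [IsManifold (𝓡 m) ∞ N]
  {k : ∀ x : M, TangentSpace (𝓡 n) x} {ψ : M → N} {W : Set M}

/-- `Φ` is a diffeomorphism from an open subset of `W` whose first component is the leaf space
projection `ψ`, in the chart around `y₀`. -/
structure IsStraightening (ψ : M → N) (W : Set M) (y₀ : N)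
    (Φ : PartialDiffeomorph (𝓡 n) 𝓘(ℝ, EuclideanSpace ℝ (Fin m) × ℝ) M
      (EuclideanSpace ℝ (Fin m) × ℝ) ∞) : Prop where
  subset : Φ.source ⊆ W ∩ ψ ⁻¹' (chartAt (EuclideanSpace ℝ (Fin m)) y₀).source
  fst_eq : ∀ x ∈ Φ.source, (Φ x).1 = extChartAt (𝓡 m) y₀ (ψ x)

namespace IsStraightening

variable {y₀ : N} {Φ : PartialDiffeomorph (𝓡 n) 𝓘(ℝ, EuclideanSpace ℝ (Fin m) × ℝ) M
      (EuclideanSpace ℝ (Fin m) × ℝ) ∞} {x : M}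

lemma contMDiffAt (hΦ : IsStraightening ψ W y₀ Φ) (hψ : IsLocalLeafSpace m k ψ W)
    (hx : x ∈ Φ.source) :
    ContMDiffAt (𝓡 n) 𝓘(ℝ, EuclideanSpace ℝ (Fin m)) ∞ (fun x ↦ extChartAt (𝓡 m) y₀ (ψ x)) x :=
  (hψ.contMDiffOn_chart y₀).contMDiffAt ((hψ.isOpen_inter_chart y₀).mem_nhds (hΦ.subset hx))

lemma mvfderiv_eq_zero_iff (hΦ : IsStraightening ψ W y₀ Φ) (hψ : IsLocalLeafSpace m k ψ W)
    (hx : x ∈ Φ.source) (v : TangentSpace (𝓡 n) x) :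
    mvfderiv (𝓡 n) (fun x ↦ extChartAt (𝓡 m) y₀ (ψ x)) x v = 0 ↔ v ∈ Submodule.span ℝ {k x} :=
  hψ.mvfderiv_chart_eq_zero_iff (hΦ.subset hx).1 (hΦ.subset hx).2 v

lemma mvfderiv_field (hΦ : IsStraightening ψ W y₀ Φ) (hψ : IsLocalLeafSpace m k ψ W)
    (hx : x ∈ Φ.source) : mvfderiv (𝓡 n) (fun x ↦ extChartAt (𝓡 m) y₀ (ψ x)) x (k x) = 0 :=
  (hΦ.mvfderiv_eq_zero_iff hψ hx _).2 (Submodule.mem_span_singleton_self _)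

/-- The derivative of `Y u` along `k`, where `u` is a leaf space projection. -/
lemma mvfderiv_mlieBracket_field (hΦ : IsStraightening ψ W y₀ Φ) (hψ : IsLocalLeafSpace m k ψ W)
    (hk : SmoothFieldAt k x) {Y : ∀ x : M, TangentSpace (𝓡 n) x} (hY : SmoothFieldAt Y x)
    (hx : x ∈ Φ.source) :
    mvfderiv (𝓡 n) (fun x ↦ extChartAt (𝓡 m) y₀ (ψ x)) x (VectorField.mlieBracket (𝓡 n) k Y x) =
      mvfderiv (𝓡 n) (fun y ↦ mvfderiv (𝓡 n) (fun x ↦ extChartAt (𝓡 m) y₀ (ψ x)) y (Y y)) x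
        (k x) := by
  rw [mvfderiv_mlieBracket (hΦ.contMDiffAt hψ hx) hk.mdifferentiableAt hY.mdifferentiableAt,
    sub_eq_self]
  have h : mvfderiv (𝓡 n)
      (fun y ↦ mvfderiv (𝓡 n) (fun x ↦ extChartAt (𝓡 m) y₀ (ψ x)) y (k y)) x =
      mvfderiv (𝓡 n) (fun _ ↦ (0 : EuclideanSpace ℝ (Fin m))) x := by
    refine Filter.EventuallyEq.mfderiv_eq (I := 𝓡 n) (I' := 𝓘(ℝ, EuclideanSpace ℝ (Fin m))) ?_
    filter_upwards [Φ.open_source.mem_nhds hx] with y hy using hΦ.mvfderiv_field hψ hy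
  rw [h, mvfderiv_const, zero_apply]

lemma mlieBracket_constantLift_mem (hΦ : IsStraightening ψ W y₀ Φ)
    (hψ : IsLocalLeafSpace m k ψ W) (hk : SmoothFieldAt k x) (hx : x ∈ Φ.source)
    (v : EuclideanSpace ℝ (Fin m)) :
    VectorField.mlieBracket (𝓡 n) k (fun y ↦ constantLift Φ y v) x ∈
      Submodule.span ℝ {k x} := by
  rw [← hΦ.mvfderiv_eq_zero_iff hψ hx,
    hΦ.mvfderiv_mlieBracket_field hψ hk (smoothFieldAt_constantLift hx v) hx]
  have h : mvfderiv (𝓡 n) (fun y ↦ mvfderiv (𝓡 n) (fun x ↦ extChartAt (𝓡 m) y₀ (ψ x)) y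
      (constantLift Φ y v)) x = mvfderiv (𝓡 n) (fun _ ↦ v) x := by
    refine Filter.EventuallyEq.mfderiv_eq (I := 𝓡 n) (I' := 𝓘(ℝ, EuclideanSpace ℝ (Fin m))) ?_
    filter_upwards [Φ.open_source.mem_nhds hx] with y hy using mvfderiv_constantLift hΦ.fst_eq hy v
  rw [h, mvfderiv_const, zero_apply]

end IsStraightening

namespace TractorEndomorphismField

variable {c : ConformalStructure n M} {A : TractorEndomorphismField c}
  {g : PseudoRiemannianMetric n M} {hg : g ∈ c.metrics} {y₀ : N}
  {Φ : PartialDiffeomorph (𝓡 n) 𝓘(ℝ, EuclideanSpace ℝ (Fin m) × ℝ) M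
      (EuclideanSpace ℝ (Fin m) × ℝ) ∞} {x : M}

lemma middle_mem_span (hO : A.IsOrthogonal) (hJ : A.IsComplexStructure)
    (hk : A.HasUnderlyingField k) {v : TangentSpace (𝓡 n) x} (hv : v ∈ Submodule.span ℝ {k x}) :
    A.middle g hg x v ∈ Submodule.span ℝ {k x} := by
  obtain ⟨t, rfl⟩ := Submodule.mem_span_singleton.1 hv
  rw [map_smul, middle_underlyingField hO hJ hk]
  exact Submodule.smul_mem _ _ (Submodule.smul_mem _ _ (Submodule.mem_span_singleton_self _))

/-- The graph of the complex structure that a complex structure on the tractor bundle induces, at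
the point `x`, on the image of `k^⊥` in the tangent space of the leaf space: the set of pairs
`(dψ ξ, dψ (K ξ))` with `ξ ∈ k^⊥`, where `K` is the middle block of `A` in the scale `g`.  The
tangent space at `ψ x` is written as the model space, so that the graphs at different points of
a fibre can be compared. -/
noncomputable def crGraph (A : TractorEndomorphismField c) (g : PseudoRiemannianMetric n M) (hg : g ∈ c.metrics)
    (k : ∀ x : M, TangentSpace (𝓡 n) x) (ψ : M → N) (x : M) :
    Submodule ℝ (EuclideanSpace ℝ (Fin m) × EuclideanSpace ℝ (Fin m)) :=
  (c.orthogonal (k x)).map (LinearMap.prod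
    ((mfderiv (𝓡 n) (𝓡 m) ψ x).toLinearMap : _ →ₗ[ℝ] EuclideanSpace ℝ (Fin m))
    ((mfderiv (𝓡 n) (𝓡 m) ψ x).toLinearMap ∘ₗ A.middle g hg x))

lemma mem_crGraph {p : EuclideanSpace ℝ (Fin m) × EuclideanSpace ℝ (Fin m)} :
    p ∈ A.crGraph (m := m) g hg k ψ x ↔ ∃ ξ, g.val x (k x) ξ = 0 ∧ mfderiv (𝓡 n) (𝓡 m) ψ x ξ = p.1 ∧
      mfderiv (𝓡 n) (𝓡 m) ψ x (A.middle g hg x ξ) = p.2 := by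
  simp only [crGraph, Submodule.mem_map, ConformalStructure.mem_orthogonal_iff hg]
  refine exists_congr fun ξ ↦ and_congr_right fun _ ↦ ?_
  rw [Prod.ext_iff]
  rfl

lemma val_eq_zero_of_mem_span (hO : A.IsOrthogonal) (hJ : A.IsComplexStructure)
    (hk : A.HasUnderlyingField k) (hg : g ∈ c.metrics) {v : TangentSpace (𝓡 n) x}
    (hv : v ∈ Submodule.span ℝ {k x}) : g.val x (k x) v = 0 := by
  obtain ⟨t, rfl⟩ := Submodule.mem_span_singleton.1 hv
  rw [map_smul, val_underlyingField_self hO hJ hk hg, smul_zero]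

lemma exists_val_ne_zero (hO : A.IsOrthogonal) (hJ : A.IsComplexStructure)
    (hk : A.HasUnderlyingField k) (g : PseudoRiemannianMetric n M) (x : M) :
    ∃ v, g.val x (k x) v ≠ 0 := by
  by_contra! h
  exact underlyingField_ne_zero hO hJ hk x (g.nondegenerate x _ h)

end TractorEndomorphismField

/-- If two functions have the same logarithmic derivative `b` in the direction `w`, then the
derivative of their quotient in this direction is zero. -/
lemma mvfderiv_mul_inv_eq_zero {f h : M → ℝ} {x : M} (hf : MDifferentiableAt (𝓡 n) 𝓘(ℝ) f x)
    (hh : MDifferentiableAt (𝓡 n) 𝓘(ℝ) h x) (hx : h x ≠ 0) {w : TangentSpace (𝓡 n) x} {b : ℝ}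
    (hfw : mvfderiv (𝓡 n) f x w = b * f x) (hhw : mvfderiv (𝓡 n) h x w = b * h x) :
    MDifferentiableAt (𝓡 n) 𝓘(ℝ) (fun y ↦ f y * (h y)⁻¹) x ∧
      mvfderiv (𝓡 n) (fun y ↦ f y * (h y)⁻¹) x w = 0 := by
  have hq : MDifferentiableAt (𝓡 n) 𝓘(ℝ) (fun y ↦ f y * (h y)⁻¹) x :=
    hf.mul (hh.inv hx)
  refine ⟨hq, ?_⟩
  have h1 : mvfderiv (𝓡 n) f x = mvfderiv (𝓡 n) ((fun y ↦ f y * (h y)⁻¹) * h) x := by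
    refine Filter.EventuallyEq.mfderiv_eq (I := 𝓡 n) (I' := 𝓘(ℝ)) ?_
    filter_upwards [hh.continuousAt.eventually_ne hx] with y hy
    simp [hy]
  rw [h1, mvfderiv_mul hq hh] at hfw
  simp [hhw] at hfw
  field_simp at hfw
  simpa [div_eq_mul_inv, hx] using hfw

namespace IsStraightening

variable {c : ConformalStructure n M} {A : TractorEndomorphismField c}
  {g : PseudoRiemannianMetric n M} {hg : g ∈ c.metrics} {y₀ : N}
  {Φ : PartialDiffeomorph (𝓡 n) 𝓘(ℝ, EuclideanSpace ℝ (Fin m) × ℝ) M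
      (EuclideanSpace ℝ (Fin m) × ℝ) ∞} {x : M}

/-- A tangent vector and the lift of its image in the leaf space agree modulo `k`. -/
lemma sub_constantLift_mem (hΦ : IsStraightening ψ W y₀ Φ) (hψ : IsLocalLeafSpace m k ψ W)
    (hx : x ∈ Φ.source) (ξ : TangentSpace (𝓡 n) x) :
    ξ - constantLift Φ x (mvfderiv (𝓡 n) (fun x ↦ extChartAt (𝓡 m) y₀ (ψ x)) x ξ) ∈
      Submodule.span ℝ {k x} := by
  rw [← hΦ.mvfderiv_eq_zero_iff hψ hx, map_sub, mvfderiv_constantLift hΦ.fst_eq hx, sub_self]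

lemma val_constantLift (hΦ : IsStraightening ψ W y₀ Φ) (hψ : IsLocalLeafSpace m k ψ W)
    (hO : A.IsOrthogonal) (hJ : A.IsComplexStructure) (hk : A.HasUnderlyingField k)
    (hg : g ∈ c.metrics) (hx : x ∈ Φ.source) (ξ : TangentSpace (𝓡 n) x) :
    g.val x (k x) (constantLift Φ x
      (mvfderiv (𝓡 n) (fun x ↦ extChartAt (𝓡 m) y₀ (ψ x)) x ξ)) = g.val x (k x) ξ := by
  have := TractorEndomorphismField.val_eq_zero_of_mem_span hO hJ hk hg
    (hΦ.sub_constantLift_mem hψ hx ξ)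
  rw [map_sub, sub_eq_zero] at this
  exact this.symm

lemma contMDiffAt_val_constantLift (hs : A.IsSmooth) (hO : A.IsOrthogonal)
    (hJ : A.IsComplexStructure) (hk : A.HasUnderlyingField k)
    (hg : g ∈ c.metrics) (hx : x ∈ Φ.source) (v : EuclideanSpace ℝ (Fin m)) :
    ContMDiffAt (𝓡 n) 𝓘(ℝ) ∞ (fun x ↦ g.val x (k x) (constantLift Φ x v)) x :=
  TractorEndomorphismField.contMDiffAt_val_underlyingField hs hO hJ hk hg
    (smoothFieldAt_constantLift hx v)

/-- There is a constant vector field on the leaf space whose lift is not orthogonal to `k`. -/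
lemma exists_val_constantLift_ne_zero (hΦ : IsStraightening ψ W y₀ Φ)
    (hψ : IsLocalLeafSpace m k ψ W) (hO : A.IsOrthogonal) (hJ : A.IsComplexStructure)
    (hk : A.HasUnderlyingField k) (hg : g ∈ c.metrics) (hx : x ∈ Φ.source) :
    ∃ v, g.val x (k x) (constantLift Φ x v) ≠ 0 := by
  obtain ⟨ξ, hξ⟩ := TractorEndomorphismField.exists_val_ne_zero hO hJ hk g x
  exact ⟨_, by rwa [hΦ.val_constantLift hψ hO hJ hk hg hx ξ]⟩

/-- The pairs in the graph of the induced complex structure, in terms of lifts. -/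
lemma mem_crGraph_iff (hΦ : IsStraightening ψ W y₀ Φ)
    (hψ : IsLocalLeafSpace m k ψ W) (hO : A.IsOrthogonal) (hJ : A.IsComplexStructure)
    (hk : A.HasUnderlyingField k) (hx : x ∈ Φ.source)
    {p : EuclideanSpace ℝ (Fin m) × EuclideanSpace ℝ (Fin m)} :
    p ∈ A.crGraph (m := m) g hg k ψ x ↔ ∃ v, g.val x (k x) (constantLift Φ x v) = 0 ∧
      (trivializationAt (EuclideanSpace ℝ (Fin m)) (TangentSpace (𝓡 m)) y₀).symmL ℝ (ψ x) v =
        p.1 ∧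
      (trivializationAt (EuclideanSpace ℝ (Fin m)) (TangentSpace (𝓡 m)) y₀).symmL ℝ (ψ x)
        (mvfderiv (𝓡 n) (fun x ↦ extChartAt (𝓡 m) y₀ (ψ x)) x
          (A.middle g hg x (constantLift Φ x v))) = p.2 := by
  have hW := hΦ.subset hx
  rw [TractorEndomorphismField.mem_crGraph]
  constructor
  · rintro ⟨ξ, hξ, h1, h2⟩
    refine ⟨_, (hΦ.val_constantLift hψ hO hJ hk hg hx ξ).trans hξ, ?_, ?_⟩
    · rw [← h1, hψ.mfderiv_eq_symmL hW.1 hW.2]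
    · rw [← h2, hψ.mfderiv_eq_symmL hW.1 hW.2]
      congr 1
      rw [← sub_eq_zero, ← map_sub, hΦ.mvfderiv_eq_zero_iff hψ hx, ← map_sub, ← neg_sub, map_neg]
      exact Submodule.neg_mem _
        (TractorEndomorphismField.middle_mem_span hO hJ hk (hΦ.sub_constantLift_mem hψ hx ξ))
  · rintro ⟨v, hv, h1, h2⟩
    refine ⟨constantLift Φ x v, hv, ?_, ?_⟩
    · rw [← h1, hψ.mfderiv_eq_symmL hW.1 hW.2, mvfderiv_constantLift hΦ.fst_eq hx]
    · rw [← h2, hψ.mfderiv_eq_symmL hW.1 hW.2]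

end IsStraightening

/-- Near each point, the induced complex structure at `x` only depends on `ψ x`. -/
lemma TractorEndomorphismField.exists_crGraph_eq {c : ConformalStructure n M}
    {A : TractorEndomorphismField c} {g : PseudoRiemannianMetric n M} {hg : g ∈ c.metrics}
    (hs : A.IsSmooth) (hO : A.IsOrthogonal)
    (hJ : A.IsComplexStructure) (hP : A.IsParallel) (hk : A.HasUnderlyingField k)
    (hψ : IsLocalLeafSpace m k ψ W) {x₀ : M} (hx₀ : x₀ ∈ W) :
    ∃ W₀ : Set M, IsOpen W₀ ∧ x₀ ∈ W₀ ∧ W₀ ⊆ W ∧ ∀ x₁ ∈ W₀, ∀ x₂ ∈ W₀, ψ x₁ = ψ x₂ →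
      A.crGraph (m := m) g hg k ψ x₁ = A.crGraph (m := m) g hg k ψ x₂ := by
  have hkd (x : M) : SmoothFieldAt k x := smoothFieldAt_underlyingField hs hk x
  obtain ⟨Φ, hx₀Φ, hΦ1, hΦ2⟩ := hψ.exists_straightening (ψ x₀) hx₀ (mem_chart_source _ _)
    (underlyingField_ne_zero hO hJ hk x₀)
  have hΦ : IsStraightening ψ W (ψ x₀) Φ := ⟨hΦ1, hΦ2⟩
  set u : M → EuclideanSpace ℝ (Fin m) := fun x ↦ extChartAt (𝓡 m) (ψ x₀) (ψ x) with hu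
  -- `α v = g(k, ξ)` for the lift `ξ` of `v`
  let α (v : EuclideanSpace ℝ (Fin m)) (x : M) : ℝ := g.val x (k x) (constantLift Φ x v)
  have hα (v : EuclideanSpace ℝ (Fin m)) {x : M} (hx : x ∈ Φ.source) :
      ContMDiffAt (𝓡 n) 𝓘(ℝ) ∞ (α v) x :=
    IsStraightening.contMDiffAt_val_constantLift hs hO hJ hk hg hx v
  have hαk (v : EuclideanSpace ℝ (Fin m)) {x : M} (hx : x ∈ Φ.source) :
      mvfderiv (𝓡 n) (α v) x (k x) =
        -2 * (A.inScale g hg x (canonicalTractor x)).2.2 * α v x :=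
    mvfderiv_val_underlyingField hs hO hJ hP hk hg (smoothFieldAt_constantLift hx v)
      (hΦ.mlieBracket_constantLift_mem hψ (hkd x) hx v)
  obtain ⟨v₀, hv₀⟩ : ∃ v, α v x₀ ≠ 0 :=
    hΦ.exists_val_constantLift_ne_zero hψ hO hJ hk hg hx₀Φ
  -- a box on which `α v₀` does not vanish
  have hne : ∀ᶠ p in nhds (Φ x₀), p ∈ Φ.target ∧ α v₀ (Φ.symm p) ≠ 0 := by
    refine Filter.Eventually.and (Φ.open_target.mem_nhds (Φ.map_source hx₀Φ)) ?_
    have h1 : ContinuousAt Φ.symm (Φ x₀) := (Φ.symm.mdifferentiableAt (by simp)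
      (Φ.map_source hx₀Φ)).continuousAt
    have h2 : Φ.symm (Φ x₀) = x₀ := Φ.left_inv hx₀Φ
    have h3 : ContinuousAt (α v₀) (Φ.symm (Φ x₀)) := by rw [h2]; exact (hα v₀ hx₀Φ).continuousAt
    exact (h3.comp h1).eventually_ne (by rw [Function.comp_apply, h2]; exact hv₀)
  obtain ⟨r, hr, hball⟩ := Metric.eventually_nhds_iff_ball.1 hne
  have hBt : Metric.ball (Φ x₀) r ⊆ Φ.target := fun p hp ↦ (hball p hp).1
  have hne' {x : M} (hx : x ∈ Φ.source) (hxB : Φ x ∈ Metric.ball (Φ x₀) r) : α v₀ x ≠ 0 := by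
    have := (hball _ hxB).2
    rwa [show Φ.symm (Φ x) = x from Φ.left_inv hx] at this
  refine ⟨Φ.source ∩ Φ ⁻¹' Metric.ball (Φ x₀) r,
    Φ.contMDiffOn.continuousOn.isOpen_inter_preimage Φ.open_source Metric.isOpen_ball,
    ⟨hx₀Φ, Metric.mem_ball_self hr⟩, fun x hx ↦ (hΦ1 hx.1).1, ?_⟩
  have hker (x : M) (hx : x ∈ Φ.source) (v : TangentSpace (𝓡 n) x)
      (hv : mvfderiv (𝓡 n) u x v = 0) : v ∈ Submodule.span ℝ {k x} :=
    (hΦ.mvfderiv_eq_zero_iff hψ hx v).1 hv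
  suffices h : ∀ x₁ ∈ Φ.source ∩ Φ ⁻¹' Metric.ball (Φ x₀) r,
      ∀ x₂ ∈ Φ.source ∩ Φ ⁻¹' Metric.ball (Φ x₀) r, ψ x₁ = ψ x₂ →
        A.crGraph (m := m) g hg k ψ x₁ ≤ A.crGraph (m := m) g hg k ψ x₂ from
    fun x₁ h₁ x₂ h₂ h₁₂ ↦ le_antisymm (h x₁ h₁ x₂ h₂ h₁₂) (h x₂ h₂ x₁ h₁ h₁₂.symm)
  rintro x₁ ⟨h₁, h₁B⟩ x₂ ⟨h₂, h₂B⟩ h₁₂ p hp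
  obtain ⟨v, hv0, hp1, hp2⟩ := (hΦ.mem_crGraph_iff hψ hO hJ hk h₁).1 hp
  have hu₁₂ : u x₁ = u x₂ := by simp only [hu, h₁₂]
  -- `α v / α v₀` is constant along the fibres, and it vanishes at `x₁`
  have hαv (x : M) (hx : x ∈ Φ.source) (hxB : Φ x ∈ Metric.ball (Φ x₀) r) (hxu : u x₁ = u x) :
      α v x = 0 := by
    have h := eq_of_mvfderiv_eq_zero (f := fun x ↦ α v x * (α v₀ x)⁻¹) hΦ2 Metric.isOpen_ball
      (convex_ball _ _) hBt h₁ h₁B hx hxB hxu hker fun z hz hzB _ ↦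
        mvfderiv_mul_inv_eq_zero ((hα v hz).mdifferentiableAt (by simp))
          ((hα v₀ hz).mdifferentiableAt (by simp)) (hne' hz hzB) (hαk v hz) (hαk v₀ hz)
    have h0 : α v x₁ = 0 := hv0
    simp only [h0, zero_mul] at h
    exact (mul_eq_zero.1 h.symm).resolve_right (inv_ne_zero (hne' hx hxB))
  -- hence so is the image of `K ξ`, where `ξ` is the lift of `v`
  have hG := eq_of_mvfderiv_eq_zero
    (f := fun x ↦ mvfderiv (𝓡 n) u x (A.middle g hg x (constantLift Φ x v))) hΦ2
    Metric.isOpen_ball (convex_ball _ _) hBt h₁ h₁B h₂ h₂B hu₁₂ hker fun z hz hzB hzu ↦ by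
      have hK : SmoothFieldAt (fun y ↦ A.middle g hg y (constantLift Φ y v)) z :=
        smoothFieldAt_middle hs (smoothFieldAt_constantLift hz v)
      refine ⟨(contMDiffAt_mvfderiv_apply (hΦ.contMDiffAt hψ hz) hK).mdifferentiableAt (by simp),
        ?_⟩
      rw [← hΦ.mvfderiv_mlieBracket_field hψ (hkd z) hK hz, hΦ.mvfderiv_eq_zero_iff hψ hz]
      have h1 := mlieBracket_middle_sub_mem (g := g) (hg := hg) hs hO hJ hP hk
        (smoothFieldAt_constantLift hz v) (hαv z hz hzB hzu.symm)
      have h2 := middle_mem_span (g := g) (hg := hg) hO hJ hk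
        (hΦ.mlieBracket_constantLift_mem hψ (hkd z) hz v)
      exact (Submodule.sub_mem_iff_left _ h2).1 h1
  refine (hΦ.mem_crGraph_iff hψ hO hJ hk h₂).2 ⟨v, hαv x₂ h₂ h₂B hu₁₂, ?_, ?_⟩
  · rw [← hp1, h₁₂]
  · rw [← hp2, ← hG, h₁₂]

end

/-! ### Smooth local sections and frames -/

section

variable {m : ℕ} {N : Type*} [TopologicalSpace N]
  [ChartedSpace (EuclideanSpace ℝ (Fin m)) N] [IsManifold (𝓡 m) ∞ N]
  {k : ∀ x : M, TangentSpace (𝓡 n) x} {ψ : M → N} {W : Set M}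

lemma smoothFieldAt_symmL {f : M → EuclideanSpace ℝ (Fin n)} {x₀ x : M}
    (hx : x ∈ (chartAt (EuclideanSpace ℝ (Fin n)) x₀).source)
    (hf : ContMDiffAt (𝓡 n) 𝓘(ℝ, EuclideanSpace ℝ (Fin n)) ∞ f x) :
    SmoothFieldAt (fun y ↦ (trivializationAt (EuclideanSpace ℝ (Fin n)) (TangentSpace (𝓡 n))
      x₀).symmL ℝ y (f y)) x := by
  refine ((trivializationAt (EuclideanSpace ℝ (Fin n)) (TangentSpace (𝓡 n))
    x₀).contMDiffAt_section_iff (IB := 𝓡 n) hx).2 (hf.congr_of_eventuallyEq ?_)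
  filter_upwards [(chartAt (EuclideanSpace ℝ (Fin n)) x₀).open_source.mem_nhds hx] with y hy
  have hy' : y ∈ (trivializationAt (EuclideanSpace ℝ (Fin n)) (TangentSpace (𝓡 n))
    x₀).baseSet := hy
  rw [Bundle.Trivialization.symmL_apply _ hy', Bundle.Trivialization.apply_mk_symm _ hy']

/-- A straightening gives smooth local sections of the projection to the leaf space. -/
lemma IsStraightening.exists_section {y₀ : N}
    {Φ : PartialDiffeomorph (𝓡 n) 𝓘(ℝ, EuclideanSpace ℝ (Fin m) × ℝ) M
      (EuclideanSpace ℝ (Fin m) × ℝ) ∞}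
    (hΦ : IsStraightening ψ W y₀ Φ) {x₀ : M} (hx₀ : x₀ ∈ Φ.source) {S : Set M}
    (hS : S ∈ nhds x₀) :
    ∃ (V : Set N) (s : N → M), IsOpen V ∧ ψ x₀ ∈ V ∧
      ∀ y ∈ V, ContMDiffAt (𝓡 m) (𝓡 n) ∞ s y ∧ s y ∈ Φ.source ∧ s y ∈ S ∧ ψ (s y) = y := by
  let E := EuclideanSpace ℝ (Fin m)
  let s (y : N) : M := Φ.symm (extChartAt (𝓡 m) y₀ y, (Φ x₀).2)
  have hy₀ : ψ x₀ ∈ (chartAt E y₀).source := (hΦ.subset hx₀).2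
  have hs₀ : s (ψ x₀) = x₀ := by
    simp only [s]
    rw [← hΦ.fst_eq x₀ hx₀]
    exact Φ.left_inv hx₀
  have hc (y : N) (hy : y ∈ (chartAt E y₀).source) : ContMDiffAt (𝓡 m)
      𝓘(ℝ, E × ℝ) ∞ (fun y ↦ (extChartAt (𝓡 m) y₀ y, (Φ x₀).2)) y :=
    (contMDiffAt_extChartAt' hy).prodMk_space contMDiffAt_const
  have hsm (y : N) (hy : y ∈ (chartAt E y₀).source)
      (hy' : (extChartAt (𝓡 m) y₀ y, (Φ x₀).2) ∈ Φ.target) :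
      ContMDiffAt (𝓡 m) (𝓡 n) ∞ s y :=
    (Φ.symm.contMDiffOn.contMDiffAt (Φ.open_target.mem_nhds hy')).comp y (hc y hy)
  have ht₀ : (extChartAt (𝓡 m) y₀ (ψ x₀), (Φ x₀).2) ∈ Φ.target := by
    rw [← hΦ.fst_eq x₀ hx₀]; exact Φ.map_source hx₀
  have hV : ∀ᶠ y in nhds (ψ x₀), y ∈ (chartAt E y₀).source ∧
      (extChartAt (𝓡 m) y₀ y, (Φ x₀).2) ∈ Φ.target ∧ s y ∈ S := by
    have h1 := (hc _ hy₀).continuousAt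
    have h2 := (hsm _ hy₀ ht₀).continuousAt
    exact Filter.Eventually.and ((chartAt E y₀).open_source.mem_nhds hy₀) (Filter.Eventually.and
      (h1.preimage_mem_nhds (Φ.open_target.mem_nhds ht₀)) (h2.preimage_mem_nhds (by rwa [hs₀])))
  obtain ⟨V, hVs, hVo, hxV⟩ := mem_nhds_iff.1 hV
  refine ⟨V, s, hVo, hxV, fun y hy ↦ ?_⟩
  obtain ⟨hy1, hy2, hy3⟩ := hVs hy
  have hsy : s y ∈ Φ.source := Φ.map_target hy2
  refine ⟨hsm y hy1 hy2, hsy, hy3, (extChartAt (𝓡 m) y₀).injOn ?_ ?_ ?_⟩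
  · rw [extChartAt_source]; exact (hΦ.subset hsy).2
  · rw [extChartAt_source]; exact hy1
  · rw [← hΦ.fst_eq _ hsy]
    exact congrArg Prod.fst (Φ.right_inv hy2)

/-- Pulled back along a local section of the projection to the leaf space, the graphs of the induced complex structures have smooth frames. -/
lemma TractorEndomorphismField.exists_section_frame {c : ConformalStructure n M}
    {A : TractorEndomorphismField c} {g : PseudoRiemannianMetric n M} {hg : g ∈ c.metrics}
    (hs : A.IsSmooth) (hO : A.IsOrthogonal) (hJ : A.IsComplexStructure)
    (hk : A.HasUnderlyingField k) (hψ : IsLocalLeafSpace m k ψ W) {W₁ : Set M} (hW₁ : IsOpen W₁)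
    (hW₁W : W₁ ⊆ W) {x₀ : M} (hx₀ : x₀ ∈ W₁) :
    ∃ V : Set N, IsOpen V ∧ ψ x₀ ∈ V ∧ ∃ s : N → M, (∀ y ∈ V, s y ∈ W₁ ∧ ψ (s y) = y) ∧
      ∃ (r : ℕ) (X Y : Fin r → ∀ y : N, TangentSpace (𝓡 m) y),
        (∀ i, SmoothFieldOn (X i) V ∧ SmoothFieldOn (Y i) V) ∧
        ∀ y ∈ V, LinearIndependent ℝ (fun i ↦ X i y) ∧
          (∀ i, ((X i y, Y i y) : EuclideanSpace ℝ (Fin m) × EuclideanSpace ℝ (Fin m)) ∈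
            A.crGraph (m := m) g hg k ψ (s y)) ∧
          ∀ p ∈ A.crGraph (m := m) g hg k ψ (s y),
            (p.1 : TangentSpace (𝓡 m) y) ∈ Submodule.span ℝ (Set.range fun i ↦ X i y) := by
  obtain ⟨Φ, hx₀Φ, hΦ1, hΦ2⟩ := hψ.exists_straightening (ψ x₀) (hW₁W hx₀) (mem_chart_source _ _)
    (underlyingField_ne_zero hO hJ hk x₀)
  have hΦ : IsStraightening ψ W (ψ x₀) Φ := ⟨hΦ1, hΦ2⟩
  let E := EuclideanSpace ℝ (Fin m)
  set u : M → E := fun x ↦ extChartAt (𝓡 m) (ψ x₀) (ψ x) with hu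
  let α (x : M) : E →ₗ[ℝ] ℝ := (g.val x (k x)).toLinearMap ∘ₗ constantLift Φ x
  have hα (v : E) {x : M} (hx : x ∈ Φ.source) : ContMDiffAt (𝓡 n) 𝓘(ℝ) ∞ (fun x ↦ α x v) x :=
    IsStraightening.contMDiffAt_val_constantLift hs hO hJ hk hg hx v
  obtain ⟨v₀, hv₀⟩ : ∃ v, α x₀ v ≠ 0 :=
    hΦ.exists_val_constantLift_ne_zero hψ hO hJ hk hg hx₀Φ
  obtain ⟨V, s, hVo, hxV, hVs⟩ := hΦ.exists_section hx₀Φ (Filter.inter_mem (hW₁.mem_nhds hx₀)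
    ((hα v₀ hx₀Φ).continuousAt.eventually_ne hv₀))
  have hsV (y : N) (hy : y ∈ V) := (hVs y hy).1
  have hsΦ (y : N) (hy : y ∈ V) := (hVs y hy).2.1
  have hne (y : N) (hy : y ∈ V) : α (s y) v₀ ≠ 0 := (hVs y hy).2.2.1.2
  have hψs (y : N) (hy : y ∈ V) := (hVs y hy).2.2.2
  have hVc (y : N) (hy : y ∈ V) : y ∈ (chartAt E (ψ x₀)).source := by
    simpa only [Set.mem_preimage, hψs y hy] using (hΦ.subset (hsΦ y hy)).2
  refine ⟨V, hVo, hxV, s, fun y hy ↦ ⟨(hVs y hy).2.2.1.1, hψs y hy⟩, ?_⟩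
  -- the projection along `v₀` of the kernel of `α x₀` to the kernel of `α (s y)`
  let ρ (y : N) (v : E) : ℝ := α (s y) v * (α (s y) v₀)⁻¹
  let P (y : N) : E →ₗ[ℝ] E :=
    LinearMap.id - ((α (s y) v₀)⁻¹ • α (s y)).smulRight v₀
  have hP (y : N) (v : E) : P y v = v - ρ y v • v₀ := by
    simp [P, ρ, mul_comm]
  have hPα (y : N) (hy : y ∈ V) (v : E) : α (s y) (P y v) = 0 := by
    have := hne y hy
    rw [hP, map_sub, map_smul, smul_eq_mul]
    simp only [ρ]
    rw [mul_assoc, inv_mul_cancel₀ this, mul_one, sub_self]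
  let G (x : M) : E →ₗ[ℝ] E := (mvfderiv (𝓡 n) u x).toLinearMap ∘ₗ A.middle g hg x ∘ₗ
    constantLift Φ x
  have hG (v : E) {x : M} (hx : x ∈ Φ.source) :
      ContMDiffAt (𝓡 n) 𝓘(ℝ, E) ∞ (fun x ↦ G x v) x :=
    contMDiffAt_mvfderiv_apply (hΦ.contMDiffAt hψ hx)
      (smoothFieldAt_middle hs (smoothFieldAt_constantLift hx v))
  have hρ (v : E) (y : N) (hy : y ∈ V) : ContMDiffAt (𝓡 m) 𝓘(ℝ) ∞ (fun y ↦ ρ y v) y :=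
    ((hα v (hsΦ y hy)).comp y (hsV y hy)).mul
      (((hα v₀ (hsΦ y hy)).comp y (hsV y hy)).inv₀ (hne y hy))
  let e := trivializationAt E (TangentSpace (𝓡 m)) (ψ x₀)
  let w := Module.finBasis ℝ (LinearMap.ker (α x₀))
  refine ⟨_, fun i y ↦ e.symmL ℝ y (P y (w i)), fun i y ↦ e.symmL ℝ y (G (s y) (P y (w i))),
    fun i ↦ ⟨fun y hy ↦ ?_, fun y hy ↦ ?_⟩, fun y hy ↦ ⟨?_, fun i ↦ ?_, fun p hp ↦ ?_⟩⟩
  · refine (smoothFieldAt_symmL (hVc y hy) ?_).contMDiffWithinAt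
    simp only [hP]
    exact contMDiffAt_const.sub ((hρ _ y hy).smul contMDiffAt_const)
  · refine (smoothFieldAt_symmL (hVc y hy) ?_).contMDiffWithinAt
    simp only [hP, map_sub, map_smul]
    exact ((hG _ (hsΦ y hy)).comp y (hsV y hy)).sub
      ((hρ _ y hy).smul ((hG _ (hsΦ y hy)).comp y (hsV y hy)))
  · have hinj : Function.Injective (e.symmL ℝ y) := by
      refine Function.LeftInverse.injective (g := e.continuousLinearMapAt ℝ y) fun v ↦ ?_
      exact e.continuousLinearMapAt_symmL (hVc y hy) v
    have hPinj : Function.Injective (P y ∘ₗ (LinearMap.ker (α x₀)).subtype) := by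
      rw [← LinearMap.ker_eq_bot, LinearMap.ker_eq_bot']
      intro v hv
      rw [LinearMap.comp_apply, Submodule.subtype_apply, hP, sub_eq_zero] at hv
      have h1 : α x₀ v = 0 := v.2
      rw [hv, map_smul, smul_eq_mul] at h1
      rw [(mul_eq_zero.1 h1).resolve_right hv₀, zero_smul] at hv
      exact Subtype.ext hv
    have h1 := w.linearIndependent.map' _ (LinearMap.ker_eq_bot.2 hPinj)
    exact h1.map' (e.symmL ℝ y).toLinearMap (LinearMap.ker_eq_bot.2 hinj)
  · exact (hΦ.mem_crGraph_iff hψ hO hJ hk (hsΦ y hy)).2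
      ⟨P y (w i), hPα y hy _, by rw [hψs y hy], by rw [hψs y hy]; rfl⟩
  · obtain ⟨v, hv, hp1, -⟩ := (hΦ.mem_crGraph_iff hψ hO hJ hk (hsΦ y hy)).1 hp
    rw [hψs y hy] at hp1
    have hv' : α (s y) v = 0 := hv
    -- `v` is the projection of an element of the kernel of `α x₀`
    let z : E := v - (α x₀ v * (α x₀ v₀)⁻¹) • v₀
    have hz : z ∈ LinearMap.ker (α x₀) := by
      rw [LinearMap.mem_ker, map_sub, map_smul, smul_eq_mul, mul_assoc, inv_mul_cancel₀ hv₀,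
        mul_one, sub_self]
    have hPz : P y z = v := by
      have := hne y hy
      rw [hP]
      simp only [ρ, z, map_sub, map_smul, hv', smul_eq_mul, zero_sub, neg_mul, neg_smul,
        sub_neg_eq_add, mul_assoc, mul_inv_cancel₀ this, mul_one, sub_add_cancel]
    let L : LinearMap.ker (α x₀) →ₗ[ℝ] TangentSpace (𝓡 m) y :=
      (e.symmL ℝ y).toLinearMap ∘ₗ P y ∘ₗ (LinearMap.ker (α x₀)).subtype
    have h1 : Submodule.map L (Submodule.span ℝ (Set.range w)) =
        Submodule.span ℝ (Set.range fun i ↦ e.symmL ℝ y (P y (w i))) := by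
      rw [Submodule.map_span, ← Set.range_comp]
      rfl
    rw [← h1, w.span_eq]
    refine ⟨⟨z, hz⟩, trivial, ?_⟩
    change e.symmL ℝ y (P y z) = p.1
    rw [hPz]
    exact hp1

end

/-! ### The almost CR structure on the leaf space -/

section

/-- A linear relation that is the graph of a map and is invariant under `(ξ, η) ↦ (η, -ξ)` is the
graph of a complex structure on its domain. -/
lemma exists_complexStructure_of_graph {E : Type*} [AddCommGroup E] [Module ℝ E]
    (C : Submodule ℝ (E × E)) (h0 : ∀ p ∈ C, p.1 = 0 → p.2 = 0)
    (hC : ∀ p ∈ C, (p.2, -p.1) ∈ C) :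
    ∃ J : C.map (LinearMap.fst ℝ E E) →ₗ[ℝ] C.map (LinearMap.fst ℝ E E),
      (∀ p ∈ C, ∀ h : p.1 ∈ C.map (LinearMap.fst ℝ E E), (J ⟨p.1, h⟩ : E) = p.2) ∧
      ∀ ξ, J (J ξ) = -ξ := by
  have hinj : Function.Injective ((LinearMap.fst ℝ E E).submoduleMap C) := by
    rw [← LinearMap.ker_eq_bot, LinearMap.ker_eq_bot']
    intro p hp
    have h1 : p.1.1 = 0 := congrArg Subtype.val hp
    exact Subtype.ext (Prod.ext h1 (h0 _ p.2 h1))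
  let e := LinearEquiv.ofBijective _ ⟨hinj, (LinearMap.fst ℝ E E).submoduleMap_surjective C⟩
  let f : C →ₗ[ℝ] C.map (LinearMap.fst ℝ E E) :=
    ((LinearMap.snd ℝ E E).domRestrict C).codRestrict _ fun p ↦ ⟨_, hC _ p.2, rfl⟩
  have hJ (p : E × E) (hp : p ∈ C) (h : p.1 ∈ C.map (LinearMap.fst ℝ E E)) :
      ((f ∘ₗ e.symm.toLinearMap) ⟨p.1, h⟩ : E) = p.2 := by
    have : e.symm ⟨p.1, h⟩ = ⟨p, hp⟩ := by
      rw [LinearEquiv.symm_apply_eq]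
      exact Subtype.ext rfl
    rw [LinearMap.comp_apply, LinearEquiv.coe_coe, this]
    rfl
  refine ⟨f ∘ₗ e.symm.toLinearMap, hJ, fun ξ ↦ ?_⟩
  obtain ⟨_, p, hp, rfl⟩ := ξ
  have h1 : (f ∘ₗ e.symm.toLinearMap) ⟨LinearMap.fst ℝ E E p, ⟨p, hp, rfl⟩⟩ =
      ⟨p.2, ⟨_, hC p hp, rfl⟩⟩ := Subtype.ext (hJ p hp _)
  rw [h1]
  exact Subtype.ext (hJ (p.2, -p.1) (hC p hp) ⟨_, hC p hp, rfl⟩)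

variable {m : ℕ} {N : Type*} [TopologicalSpace N]
  [ChartedSpace (EuclideanSpace ℝ (Fin m)) N] [IsManifold (𝓡 m) ∞ N]
  {k : ∀ x : M, TangentSpace (𝓡 n) x} {ψ : M → N} {W : Set M}

namespace TractorEndomorphismField

variable {c : ConformalStructure n M} {A : TractorEndomorphismField c}
  {g : PseudoRiemannianMetric n M} {hg : g ∈ c.metrics} {x : M}

lemma mem_complexLine_iff (hO : A.IsOrthogonal) (hJ : A.IsComplexStructure)
    (hk : A.HasUnderlyingField k) {t : TractorSlots n x} :
    t ∈ A.complexLine g hg x ↔ t.1 = 0 ∧ t.2.1 ∈ Submodule.span ℝ {k x} := by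
  rw [complexLine, Submodule.mem_span_pair, inScale_canonicalTractor hO hJ hk,
    Submodule.mem_span_singleton]
  constructor
  · rintro ⟨a, b, rfl⟩
    exact ⟨by simp [canonicalTractor], b, by simp [canonicalTractor]⟩
  · rintro ⟨h1, b, hb⟩
    refine ⟨t.2.2 - b * (A.inScale g hg x (canonicalTractor x)).2.2, b, ?_⟩
    ext1
    · simp [canonicalTractor, h1]
    · ext1 <;> simp [canonicalTractor, hb]

/-- The condition defining the induced complex structure, in terms of the middle block. -/
lemma tractorConnection_sub_mem_complexLine_iff (hO : A.IsOrthogonal) (hJ : A.IsComplexStructure)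
    (hk : A.HasUnderlyingField k) {ξ : TangentSpace (𝓡 n) x} (hξ : g.val x (k x) ξ = 0)
    (η : TangentSpace (𝓡 n) x) :
    tractorConnection g canonicalTractor x η
        - A.inScale g hg x (tractorConnection g canonicalTractor x ξ) ∈ A.complexLine g hg x ↔
      η - A.middle g hg x ξ ∈ Submodule.span ℝ {k x} := by
  rw [tractorConnection_canonicalTractor, tractorConnection_canonicalTractor, inScale_apply,
    mem_complexLine_iff hO hJ hk, inScale_canonicalTractor hO hJ hk]
  simp only [zero_smul, zero_add, Prod.fst_sub, Prod.snd_sub, Prod.fst_add, Prod.snd_add,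
    Prod.smul_fst, Prod.smul_snd, inScale_middle_fst hO hJ hk, hξ, ← middle_apply]
  simp only [neg_zero, smul_zero, add_zero, sub_zero, true_and]
  rw [← sub_sub]
  exact Submodule.sub_mem_iff_left _
    (Submodule.smul_mem _ _ (Submodule.mem_span_singleton_self _))

lemma snd_eq_zero_of_mem_crGraph (hO : A.IsOrthogonal) (hJ : A.IsComplexStructure)
    (hk : A.HasUnderlyingField k) (hψ : IsLocalLeafSpace m k ψ W) (hx : x ∈ W)
    {p : EuclideanSpace ℝ (Fin m) × EuclideanSpace ℝ (Fin m)}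
    (hp : p ∈ A.crGraph (m := m) g hg k ψ x) (hp0 : p.1 = 0) : p.2 = 0 := by
  obtain ⟨ξ, -, h1, h2⟩ := mem_crGraph.1 hp
  rw [← h2]
  exact (hψ.ker_eq x hx _).2 (middle_mem_span hO hJ hk ((hψ.ker_eq x hx _).1 (h1.trans hp0)))

lemma swap_mem_crGraph (hO : A.IsOrthogonal) (hJ : A.IsComplexStructure)
    (hk : A.HasUnderlyingField k) (hψ : IsLocalLeafSpace m k ψ W) (hx : x ∈ W)
    {p : EuclideanSpace ℝ (Fin m) × EuclideanSpace ℝ (Fin m)}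
    (hp : p ∈ A.crGraph (m := m) g hg k ψ x) :
    (p.2, -p.1) ∈ A.crGraph (m := m) g hg k ψ x := by
  obtain ⟨ξ, hξ, h1, h2⟩ := mem_crGraph.1 hp
  refine mem_crGraph.2 ⟨A.middle g hg x ξ, val_middle hO hJ hk hξ, h2, ?_⟩
  have hkx : mfderiv (𝓡 n) (𝓡 m) ψ x (k x) = 0 :=
    (hψ.ker_eq x hx _).2 (Submodule.mem_span_singleton_self _)
  rw [middle_middle hO hJ hk hξ, map_sub, map_smul, hkx, smul_zero, sub_zero, map_neg]
  exact congrArg Neg.neg h1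

lemma map_fst_crGraph : (A.crGraph (m := m) g hg k ψ x).map (LinearMap.fst ℝ _ _) =
    (c.orthogonal (k x)).map (mfderiv (𝓡 n) (𝓡 m) ψ x).toLinearMap := by
  rw [crGraph, ← Submodule.map_comp]
  rfl

lemma finrank_map_orthogonal (hO : A.IsOrthogonal) (hJ : A.IsComplexStructure)
    (hk : A.HasUnderlyingField k) (hψ : IsLocalLeafSpace m k ψ W) (hx : x ∈ W) :
    Module.finrank ℝ ((c.orthogonal (k x)).map (mfderiv (𝓡 n) (𝓡 m) ψ x).toLinearMap) + 1 =
      m := by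
  obtain ⟨g, hg⟩ := c.nonempty
  obtain ⟨R, hR⟩ := LinearMap.exists_rightInverse_of_surjective
    (mfderiv (𝓡 n) (𝓡 m) ψ x).toLinearMap (LinearMap.range_eq_top.2 (hψ.submersion x hx))
  have hR' (w : TangentSpace (𝓡 m) (ψ x)) : mfderiv (𝓡 n) (𝓡 m) ψ x (R w) = w :=
    LinearMap.congr_fun hR w
  -- the linear form that `g(k, ·)` induces on the tangent space of the leaf space
  let β : TangentSpace (𝓡 m) (ψ x) →ₗ[ℝ] ℝ := (g.val x (k x)).toLinearMap ∘ₗ R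
  have hβ (ξ : TangentSpace (𝓡 n) x) : β (mfderiv (𝓡 n) (𝓡 m) ψ x ξ) = g.val x (k x) ξ := by
    have h : R (mfderiv (𝓡 n) (𝓡 m) ψ x ξ) - ξ ∈ Submodule.span ℝ {k x} := by
      rw [← hψ.ker_eq x hx, map_sub, hR', sub_self]
    have := val_eq_zero_of_mem_span hO hJ hk hg h
    rwa [map_sub, sub_eq_zero] at this
  have hker : (c.orthogonal (k x)).map (mfderiv (𝓡 n) (𝓡 m) ψ x).toLinearMap =
      LinearMap.ker β := by
    ext w
    rw [LinearMap.mem_ker, Submodule.mem_map]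
    constructor
    · rintro ⟨ξ, hξ, rfl⟩
      exact (hβ ξ).trans (hξ g hg)
    · exact fun hw ↦ ⟨R w, (ConformalStructure.mem_orthogonal_iff hg).2 hw, hR' w⟩
  have hβ0 : β ≠ 0 := by
    obtain ⟨v, hv⟩ := exists_val_ne_zero hO hJ hk g x
    intro h
    exact hv (by rw [← hβ, h, LinearMap.zero_apply])
  have : Module.Finite ℝ (TangentSpace (𝓡 m) (ψ x)) :=
    inferInstanceAs (Module.Finite ℝ (EuclideanSpace ℝ (Fin m)))
  rw [hker, Module.Dual.finrank_ker_add_one_of_ne_zero hβ0]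
  exact finrank_euclideanSpace_fin

/-- If the graph of the induced complex structure is constant along the fibres of the leaf space
projection, then these graphs form an almost CR structure on the leaf space. -/
lemma exists_isInherited_of_crGraph_eq (hs : A.IsSmooth) (hO : A.IsOrthogonal)
    (hJ : A.IsComplexStructure) (hk : A.HasUnderlyingField k) (hg : g ∈ c.metrics)
    (hψ : IsLocalLeafSpace m k ψ W)
    {W₁ : Set M} (hW₁ : IsOpen W₁) (hW₁W : W₁ ⊆ W) {U : Set N} (hU : ψ '' W₁ = U)
    (h : ∀ x₁ ∈ W₁, ∀ x₂ ∈ W₁, ψ x₁ = ψ x₂ →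
      A.crGraph (m := m) g hg k ψ x₁ = A.crGraph (m := m) g hg k ψ x₂) :
    ∃ S : AlmostCRStructureOn m U, IsInherited A k ψ W₁ S := by
  classical
  let E := EuclideanSpace ℝ (Fin m)
  -- outside of the image, the zero relation is a harmless value
  let Γ (y : N) : Submodule ℝ (E × E) :=
    if hy : ∃ x ∈ W₁, ψ x = y then A.crGraph (m := m) g hg k ψ hy.choose else ⊥
  have hΓ (x : M) (hx : x ∈ W₁) : Γ (ψ x) = A.crGraph (m := m) g hg k ψ x := by
    have hy : ∃ x' ∈ W₁, ψ x' = ψ x := ⟨x, hx, rfl⟩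
    simp only [Γ, dif_pos hy]
    exact h _ hy.choose_spec.1 x hx hy.choose_spec.2
  have hΓ' (y : N) : (∀ p ∈ Γ y, p.1 = 0 → p.2 = 0) ∧ ∀ p ∈ Γ y, (p.2, -p.1) ∈ Γ y := by
    by_cases hy : ∃ x ∈ W₁, ψ x = y
    · obtain ⟨x, hx, rfl⟩ := hy
      rw [hΓ x hx]
      exact ⟨fun p hp ↦ snd_eq_zero_of_mem_crGraph hO hJ hk hψ (hW₁W hx) hp,
        fun p hp ↦ swap_mem_crGraph hO hJ hk hψ (hW₁W hx) hp⟩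
    · simp only [Γ, dif_neg hy, Submodule.mem_bot]
      exact ⟨fun p hp _ ↦ by rw [hp]; rfl, fun p hp ↦ by rw [hp]; simp⟩
  let H (y : N) : Submodule ℝ (TangentSpace (𝓡 m) y) := (Γ y).map (LinearMap.fst ℝ E E)
  have hex (y : N) : ∃ J : H y →ₗ[ℝ] H y, (∀ p ∈ Γ y, ∀ h : (p.1 : TangentSpace (𝓡 m) y) ∈ H y,
      (J ⟨p.1, h⟩ : TangentSpace (𝓡 m) y) = p.2) ∧ ∀ ξ, J (J ξ) = -ξ :=
    exists_complexStructure_of_graph (Γ y) (hΓ' y).1 (hΓ' y).2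
  choose J hJΓ hJJ using hex
  have hH (x : M) (hx : x ∈ W₁) :
      H (ψ x) = (c.orthogonal (k x)).map (mfderiv (𝓡 n) (𝓡 m) ψ x).toLinearMap := by
    rw [← map_fst_crGraph (g := g) (hg := hg), ← hΓ x hx]
    rfl
  let S : AlmostCRStructureOn m U :=
    { H := H
      J := J
      corank_one := by
        rintro y hy
        obtain ⟨x, hx, rfl⟩ := hU ▸ hy
        rw [hH x hx]
        exact finrank_map_orthogonal hO hJ hk hψ (hW₁W hx)
      J_sq := fun y _ ξ ↦ hJJ y ξ
      smooth := by
        rintro y hy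
        obtain ⟨x, hx, rfl⟩ := hU ▸ hy
        obtain ⟨V, hVo, hxV, s, hsV, r, X, Y, hXY, hVX⟩ := exists_section_frame (g := g) (hg := hg)
          hs hO hJ hk hψ hW₁ hW₁W hx
        have hΓs (y : N) (hy : y ∈ V) : Γ y = A.crGraph (m := m) g hg k ψ (s y) := by
          rw [← hΓ _ (hsV y hy).1, (hsV y hy).2]
        have hmem (i : Fin r) (y : N) (hy : y ∈ V) : ((X i y, Y i y) : E × E) ∈ Γ y := by
          rw [hΓs y hy]; exact (hVX y hy).2.1 i
        have hXH (i : Fin r) (y : N) (hy : y ∈ V) :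
            X i y ∈ H y := ⟨_, hmem i y hy, rfl⟩
        let X' (i : Fin r) (y : N) : H y :=
          if hi : X i y ∈ H y then ⟨X i y, hi⟩ else 0
        have hX' (i : Fin r) (y : N) (hy : y ∈ V) : X' i y = ⟨X i y, hXH i y hy⟩ :=
          dif_pos (hXH i y hy)
        refine ⟨V, hVo, hxV, fun y hy ↦ ?_, r, X', fun y hy ↦ ⟨?_, ?_⟩, fun i ↦ ⟨?_, ?_⟩⟩
        · rw [← hU]
          exact ⟨s y, (hsV y hy).1, (hsV y hy).2⟩
        · refine LinearIndependent.of_comp (H y).subtype ?_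
          have : (H y).subtype ∘ (fun i ↦ X' i y) = fun i ↦ X i y :=
            funext fun i ↦ congrArg Subtype.val (hX' i y hy)
          rw [this]
          exact (hVX y hy).1
        · rw [eq_top_iff]
          rintro ⟨w, p, hp, hpw⟩ -
          have h1 := (hVX y hy).2.2 p (hΓs y hy ▸ hp)
          have h2 : (fun i ↦ X i y) = (H y).subtype ∘ (fun i ↦ X' i y) :=
            funext fun i ↦ (congrArg Subtype.val (hX' i y hy)).symm
          rw [h2, Set.range_comp, ← Submodule.map_span] at h1
          obtain ⟨z, hz, hzp⟩ := h1
          exact (Subtype.ext (hzp.trans hpw) : z = ⟨w, p, hp, hpw⟩) ▸ hz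
        · refine (hXY i).1.congr fun y hy ↦ ?_
          exact congrArg (Bundle.TotalSpace.mk y) (congrArg Subtype.val (hX' i y hy))
        · refine (hXY i).2.congr fun y hy ↦ congrArg (Bundle.TotalSpace.mk y) ?_
          exact (congrArg (fun z ↦ (J y z : TangentSpace (𝓡 m) y)) (hX' i y hy)).trans
            (hJΓ y _ (hmem i y hy) _) }
  refine ⟨S, hH, fun g' hg' x hx ξ hξ η hη hξH ↦ ?_⟩
  have hξ0 : g.val x (k x) ξ = 0 := hξ g hg
  have hp : ((mfderiv (𝓡 n) (𝓡 m) ψ x ξ, mfderiv (𝓡 n) (𝓡 m) ψ x (A.middle g hg x ξ)) : E × E) ∈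
      Γ (ψ x) := by
    rw [hΓ x hx]; exact mem_crGraph.2 ⟨ξ, hξ0, rfl, rfl⟩
  rw [tractorConnection_sub_mem_complexLine_iff hO hJ hk (hξ g' hg')]
  have h1 : (S.J (ψ x) ⟨mfderiv (𝓡 n) (𝓡 m) ψ x ξ, hξH⟩ : TangentSpace (𝓡 m) (ψ x)) =
      mfderiv (𝓡 n) (𝓡 m) ψ x (A.middle g hg x ξ) := hJΓ (ψ x) _ hp hξH
  rw [h1, eq_comm, ← sub_eq_zero, ← map_sub, hψ.ker_eq x (hW₁W hx),
    ← Submodule.sub_mem_iff_left _ (middle_sub_middle_mem (hg := hg) (hg' := hg') hO hJ hk hξ0)]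
  rw [show η - A.middle g hg x ξ - (A.middle g' hg' x ξ - A.middle g hg x ξ) =
    η - A.middle g' hg' x ξ by abel]

end TractorEndomorphismField

end

end ConformalTractor

theorem corollary2p4 {n : ℕ} (hn : 3 ≤ n) {M : Type*} [TopologicalSpace M]
    [ChartedSpace (EuclideanSpace ℝ (Fin n)) M] [IsManifold (𝓡 n) ∞ M]
    (c : ConformalTractor.ConformalStructure n M)
    (A : ConformalTractor.TractorEndomorphismField c)
    (hA_smooth : A.IsSmooth) (hA_orth : A.IsOrthogonal) (hA_cpx : A.IsComplexStructure)
    (hA_par : A.IsParallel)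
    (k : ∀ x : M, TangentSpace (𝓡 n) x) (hk : A.HasUnderlyingField k)
    {m : ℕ} {N : Type*} [TopologicalSpace N]
    [ChartedSpace (EuclideanSpace ℝ (Fin m)) N] [IsManifold (𝓡 m) ∞ N]
    (ψ : M → N) (W : Set M) (hψ : ConformalTractor.IsLocalLeafSpace m k ψ W) :
    ((∀ y : N, IsPreconnected (W ∩ ψ ⁻¹' {y})) →
      ∃ S : ConformalTractor.AlmostCRStructureOn m (Set.univ : Set N),
        ConformalTractor.IsInherited A k ψ W S) ∧
    ∀ x ∈ W, ∃ W₀ : Set M, IsOpen W₀ ∧ x ∈ W₀ ∧ W₀ ⊆ W ∧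
      ∀ W₁ : Set M, IsOpen W₁ → W₁ ⊆ W₀ →
        ∃ S : ConformalTractor.AlmostCRStructureOn m (ψ '' W₁),
          ConformalTractor.IsInherited A k ψ W₁ S := by
  obtain ⟨g, hg⟩ := c.nonempty
  have hloc (x : M) (hx : x ∈ W) := ConformalTractor.TractorEndomorphismField.exists_crGraph_eq
    (hg := hg) hA_smooth hA_orth hA_cpx hA_par hk hψ hx
  refine ⟨fun hconn ↦ ?_, fun x hx ↦ ?_⟩
  · refine ConformalTractor.TractorEndomorphismField.exists_isInherited_of_crGraph_eq hA_smooth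
      hA_orth hA_cpx hk hg hψ hψ.isOpen subset_rfl hψ.surjOn fun x₁ h₁ x₂ h₂ h₁₂ ↦ ?_
    -- a locally constant function on a preconnected fibre is constant
    refine (hconn (ψ x₂)).induction₂
      (fun x₁ x₂ ↦ A.crGraph (m := m) g hg k ψ x₁ = A.crGraph (m := m) g hg k ψ x₂)
      (fun x hx ↦ ?_) (fun _ _ _ _ _ _ ↦ Eq.trans) (fun _ _ _ _ ↦ Eq.symm) ⟨h₁, h₁₂⟩ ⟨h₂, rfl⟩
    obtain ⟨W₀, hW₀, hxW₀, -, h⟩ := hloc x hx.1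
    filter_upwards [inter_mem_nhdsWithin _ (hW₀.mem_nhds hxW₀)] with z hz
    exact h x hxW₀ z hz.2 (hx.2.trans hz.1.2.symm)
  · obtain ⟨W₀, hW₀, hxW₀, hW₀W, h⟩ := hloc x hx
    exact ⟨W₀, hW₀, hxW₀, hW₀W, fun W₁ hW₁ hW₁₀ ↦
      ConformalTractor.TractorEndomorphismField.exists_isInherited_of_crGraph_eq hA_smooth
        hA_orth hA_cpx hk hg hψ hW₁ (hW₁₀.trans hW₀W) rfl
        fun x₁ h₁ x₂ h₂ ↦ h x₁ (hW₁₀ h₁) x₂ (hW₁₀ h₂)⟩
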